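/- **Setting.** Let $d\ge 1$ and let $\Omega\subseteq\mathbb R^d$ be a bounded polyhedral Lipschitz domain with $\partial\Omega=\Gamma_D\cup\Gamma_N$, $\Gamma_D\cap\Gamma_N=\emptyset$ and $\Gamma_D$ closed (the result holds for every open $\Omega=\operatorname{int}\overline\Omega$ whose closure admits a finite triangulation). Let $\mathcal T_h$ be a conforming triangulation of $\overline\Omega$ into finitely many non-degenerate $d$-simplices (elements). Their $(d-1)$-dimensional faces are called sides; a side is interior if it belongs to two elements and a boundary side if it belongs to exactly one. Denote by $x_S$ the barycenter of a side $S$ and by $n_T$ the outward unit normal of an element $T$. Functions are identified if they agree almost everywhere. Let * $\mathcal S^{1,cr}_D(\mathcal T_h)$ be the space of $v_h:\Omega\to\mathbb R$ that are affine on each element, continuous at $x_S$ for every interior side $S$, and zero at $x_S$ for every boundary side $S\subseteq\Gamma_D$; * $\mathcal{RT}^0_N(\mathcal T_h)$ be the space of vector fields $y_h:\Omega\to\mathbb R^d$ that are affine on each element $T$, with $y_h|_T\cdot n_T$ constant on every side of $T$, with $y_h|_{T}\cdot n_{T}+y_h|_{T'}\cdot n_{T'}=0$ on every interior side $T\cap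 T'$, and with $y_h\cdot n=0$ on $\Gamma_N$. Let $\nabla_h$ be the element-wise gradient and $\Pi_h$ the $L^2$-projection onto element-wise constant functions or fields, $\Pi_hv|_T=\frac1{|T|}\int_T v\,dx$. Let $\phi:\mathbb R^d\to\mathbb R\cup\{+\infty\}$ be proper, convex and lower semi-continuous. Let $\psi_h:\Omega\times\mathbb R\to\mathbb R\cup\{+\infty\}$ be such that $\psi_h(x,\cdot)$ is proper, convex and lower semi-continuous for a.e. $x\in\Omega$, and such that $\psi_h$ is element-wise constant in $x$, i.e. for every element $T$ there is a function $g_T:\mathbb R\to\mathbb R\cup\{+\infty\}$ with $\psi_h(x,\cdot)=g_T$ for a.e. $x\in T$. Let $\phi^*(y)=\sup_{x\in\mathbb R^d}(y\cdot x-\phi(x))$ and $\psi_h^*(x,s)=\sup_{t\in\mathbb R}(st-\psi_h(x,t))$ be the Fenchel conjugates. Derivatives $D\psi_h$, $D\psi_h^*$ are with respect to the second argument, and $C^1$ functions are understood to be real-valued. Consider $$I_h^{cr}(v_h)=\int_\Omega\phi(\nabla_hv_h)\,dx+\int_\Omega\psi_h(\cdot,\Pi_hv_h)\,dx,\qquad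 v_h\in\mathcal S^{1,cr}_D(\mathcal T_h),$$ $$D_h^{rt}(y_h)=-\int_\Omega\phi^*(\Pi_hy_h)\,dx-\int_\Omega\psi_h^*(\cdot,\operatorname{div}y_h)\,dx,\qquad y_h\in\mathcal{RT}^0_N(\mathcal T_h).$$ **Proposition (generalized Marini formulas).** (i) Suppose $\phi\in C^1(\mathbb R^d)$ and $\psi_h(x,\cdot)\in C^1(\mathbb R)$ for a.e. $x\in\Omega$, and let $u_h\in\mathcal S^{1,cr}_D(\mathcal T_h)$ be a minimizer of $I_h^{cr}$. Then $$z_h=D\phi(\nabla_hu_h)+\frac{D\psi_h(\cdot,\Pi_hu_h)}{d}\,(\mathrm{id}_{\mathbb R^d}-\Pi_h\mathrm{id}_{\mathbb R^d})$$ (a.e. in $\Omega$) belongs to $\mathcal{RT}^0_N(\mathcal T_h)$, is a maximizer of $D_h^{rt}$, and satisfies $I_h^{cr}(u_h)=D_h^{rt}(z_h)$. (ii) Suppose $\phi^*\in C^1(\mathbb R^d)$ and $\psi_h^*(x,\cdot)\in C^1(\mathbb R)$ for a.e. $x\in\Omega$, and let $z_h\in\mathcal{RT}^0_N(\mathcal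 T_h)$ be a maximizer of $D_h^{rt}$. Then $$u_h=D\psi_h^*(\cdot,\operatorname{div}z_h)+D\phi^*(\Pi_hz_h)\cdot(\mathrm{id}_{\mathbb R^d}-\Pi_h\mathrm{id}_{\mathbb R^d})$$ (a.e. in $\Omega$) belongs to $\mathcal S^{1,cr}_D(\mathcal T_h)$, is a minimizer of $I_h^{cr}$, and satisfies $I_h^{cr}(u_h)=D_h^{rt}(z_h)$. -/

import Mathlib

open MeasureTheory Set

noncomputable section

namespace Marini

/-- The space `ℝ^d` with its Euclidean structure. -/
abbrev E (d : ℕ) : Type := EuclideanSpace ℝ (Fin d)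

/-! ### Convex analysis for functions with values in `ℝ ∪ {±∞}` -/

section Convex

variable {H : Type*} [NormedAddCommGroup H] [InnerProductSpace ℝ H]

/-- `f : H → ℝ ∪ {+∞}` is proper, convex and lower semi-continuous. Convexity is convexity of the
epigraph. -/
structure ProperConvexLSC (f : H → EReal) : Prop where
  ne_bot : ∀ x, f x ≠ ⊥
  exists_ne_top : ∃ x, f x ≠ ⊤
  convex : Convex ℝ {p : H × ℝ | f p.1 ≤ (p.2 : EReal)}
  lsc : LowerSemicontinuous f

/-- The Fenchel conjugate `f*(y) = sup_x (⟨y, x⟩ - f x)`, with `H* = H` through the inner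
product. -/
def conj (f : H → EReal) (y : H) : EReal :=
  ⨆ x : H, ((inner ℝ y x : ℝ) : EReal) - f x

/-- `f ∈ C¹(H)`: the function `f` is real-valued and continuously differentiable. -/
def IsC1 (f : H → EReal) : Prop :=
  (∀ x, f x ≠ ⊤ ∧ f x ≠ ⊥) ∧ ContDiff ℝ 1 (fun x => (f x).toReal)

/-- The derivative `Df`, as a gradient, of a real-valued `f` on `H`. -/
def D [CompleteSpace H] (f : H → EReal) (x : H) : H :=
  gradient (fun x' => (f x').toReal) x

end Convex

/-- The integral `∫_Ω f dx ∈ ℝ ∪ {±∞}` of an extended real function, as the integral of the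
positive part minus the integral of the negative part. -/
def eintegral {d : ℕ} (Ω : Set (E d)) (f : E d → EReal) : EReal :=
  ((∫⁻ x in Ω, (f x).toENNReal : ENNReal) : EReal)
    - ((∫⁻ x in Ω, (-(f x)).toENNReal : ENNReal) : EReal)

/-! ### Triangulations -/

/-- A conforming triangulation of `Ω ⊆ ℝ^d`: a finite simplicial complex (its cells are given by
their finite sets of vertices) whose cells cover exactly the closure of `Ω`. -/
structure Triangulation (d : ℕ) (Ω : Set (E d)) extends Geometry.SimplicialComplex ℝ (E d) where
  finite_faces : faces.Finite
  space_eq : toSimplicialComplex.space = closure Ω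

namespace Triangulation

variable {d : ℕ} {Ω : Set (E d)} (𝒯 : Triangulation d Ω)

/-- The elements: the `d`-dimensional simplices of the triangulation, as sets of `d + 1`
vertices. The element itself is `convexHull ℝ T`. -/
def elements : Finset (Finset (E d)) :=
  𝒯.finite_faces.toFinset.filter (fun T => T.card = d + 1)

/-- The sides: the `(d - 1)`-dimensional simplices of the triangulation. A side is a side of the
element `T` if and only if `S ⊆ T`. -/
def sides : Set (Finset (E d)) :=
  {S | S ∈ 𝒯.faces ∧ S.card = d}

/-- The boundary sides: the sides of exactly one element. -/
def boundarySides : Set (Finset (E d)) :=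
  {S | S ∈ 𝒯.sides ∧ ∃! T, T ∈ 𝒯.elements ∧ S ⊆ T}

/-- The barycenter `x_S` of a side. -/
def barycenter (S : Finset (E d)) : E d :=
  (d : ℝ)⁻¹ • ∑ z ∈ S, z

/-- `n` is the outward unit normal to the element `T` on its side `S ⊆ T`. -/
def IsOutwardNormal (T S : Finset (E d)) (n : E d) : Prop :=
  ‖n‖ = 1 ∧ (∀ x ∈ S, ∀ y ∈ S, inner ℝ n (x - y) = 0) ∧
    ∀ x ∈ S, ∀ w ∈ T \ S, inner ℝ n (w - x) < 0

/-- On every element `T`, `v` is the affine function `p T`. A function on `Ω` is considered up to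
values on the union of the boundaries of the elements, a null set; the traces of `v|_T` on the
boundary of `T` are those of `p T`. The function `v` belongs to `L^1(𝒯)^l`, the element-wise
polynomials of degree at most one, if there is such a `p`, and `p T` is determined by `v` for
every element `T`. -/
def IsPiecewise {F : Type*} [NormedAddCommGroup F] [NormedSpace ℝ F]
    (v : E d → F) (p : Finset (E d) → (E d →ᵃ[ℝ] F)) : Prop :=
  ∀ T ∈ 𝒯.elements, EqOn v (p T) (interior (convexHull ℝ (T : Set (E d))))

/-- The Crouzeix--Raviart space `S^{1,cr}_D(𝒯)`: element-wise affine functions that are continuous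
at the barycenters of the interior sides and vanish at the barycenters of the boundary sides
contained in `ΓD`. -/
def crSpace (ΓD : Set (E d)) : Set (E d → ℝ) :=
  {v | ∃ p : Finset (E d) → (E d →ᵃ[ℝ] ℝ), 𝒯.IsPiecewise v p ∧
    (∀ S ∈ 𝒯.sides, ∀ T ∈ 𝒯.elements, ∀ T' ∈ 𝒯.elements, S ⊆ T → S ⊆ T' →
      p T (barycenter S) = p T' (barycenter S)) ∧
    (∀ S ∈ 𝒯.boundarySides, convexHull ℝ (S : Set (E d)) ⊆ ΓD →
      ∀ T ∈ 𝒯.elements, S ⊆ T → p T (barycenter S) = 0)}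

/-- The Raviart--Thomas space `RT^0_N(𝒯)`: element-wise affine vector fields whose normal component
is constant on every side of every element and continuous across interior sides, and vanishes
on `ΓN`. -/
def rtSpace (ΓN : Set (E d)) : Set (E d → E d) :=
  {y | ∃ p : Finset (E d) → (E d →ᵃ[ℝ] E d), 𝒯.IsPiecewise y p ∧
    (∀ S ∈ 𝒯.sides, ∀ T ∈ 𝒯.elements, S ⊆ T → ∀ n, IsOutwardNormal T S n →
      ∃ c : ℝ, ∀ x ∈ convexHull ℝ (S : Set (E d)), inner ℝ (p T x) n = c) ∧
    (∀ S ∈ 𝒯.sides, ∀ T ∈ 𝒯.elements, ∀ T' ∈ 𝒯.elements, T ≠ T' → S ⊆ T → S ⊆ T' →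
      ∀ n n', IsOutwardNormal T S n → IsOutwardNormal T' S n' →
      ∀ x ∈ convexHull ℝ (S : Set (E d)), inner ℝ (p T x) n + inner ℝ (p T' x) n' = 0) ∧
    (∀ S ∈ 𝒯.boundarySides, ∀ T ∈ 𝒯.elements, S ⊆ T → ∀ n, IsOutwardNormal T S n →
      ∀ x ∈ convexHull ℝ (S : Set (E d)) ∩ ΓN, inner ℝ (p T x) n = 0)}

/-- The local `L²`-projection `Π_h` onto element-wise constant functions: on (the interior of) the
element `T` it is the mean value of `v` over `T`. -/
def proj {F : Type*} [NormedAddCommGroup F] [NormedSpace ℝ F] (v : E d → F) (x : E d) : F :=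
  ∑ T ∈ 𝒯.elements, (interior (convexHull ℝ (T : Set (E d)))).indicator
    (fun _ => ⨍ y in convexHull ℝ (T : Set (E d)), v y) x

end Triangulation

variable {d : ℕ}

/-- The element-wise gradient `∇_h v`. For `v ∈ L^1(𝒯)` it is the gradient of `v|_T` at the interior
points of each element `T`, hence almost everywhere. -/
def gradh (v : E d → ℝ) (x : E d) : E d := gradient v x

/-- The divergence `div y = ∑_i ∂_i y_i`. For `y ∈ RT^0(𝒯)` it is the divergence of `y|_T` at the
interior points of each element `T`, hence almost everywhere. -/
def divh (y : E d → E d) (x : E d) : ℝ :=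
  ∑ i : Fin d, (fderiv ℝ y x (EuclideanSpace.single i 1)) i

/-- The discrete primal functional
`I_h^cr(v) = ∫_Ω φ(∇_h v) dx + ∫_Ω ψ(x, Π_h v(x)) dx`. -/
def primal {Ω : Set (E d)} (𝒯 : Triangulation d Ω) (φ : E d → EReal) (ψ : E d → ℝ → EReal)
    (v : E d → ℝ) : EReal :=
  eintegral Ω (fun x => φ (gradh v x)) + eintegral Ω (fun x => ψ x (𝒯.proj v x))

/-- The discrete dual functional
`D_h^rt(y) = - ∫_Ω φ*(Π_h y) dx - ∫_Ω ψ*(x, div y(x)) dx`. -/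
def dual {Ω : Set (E d)} (𝒯 : Triangulation d Ω) (φ : E d → EReal) (ψ : E d → ℝ → EReal)
    (y : E d → E d) : EReal :=
  -eintegral Ω (fun x => conj φ (𝒯.proj y x)) - eintegral Ω (fun x => conj (ψ x) (divh y x))

end Marini

end

/-!
The proof reduces both functionals to finite sums over the elements. On an element `T` with
barycenter `x_T`, a Raviart--Thomas field has the form `a + b (x - x_T)`, so that its mean is `a` and
its divergence is `d b`; a Crouzeix--Raviart function enters only through its gradient and its value
at `x_T`, which is its mean.

The two spaces are annihilators of each other for the pairing
`∑ T, |T| (⟨a_T, ∇v_T⟩ + d b_T v_T(x_T))`, i.e. `∫ ⟨Π_h y, ∇_h v⟩ + div y Π_h v`. By element-wise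
integration by parts (`IsCell.local_parts`, an identity for barycentric coordinates) the pairing is a
sum over sides `S` of the values `v_T(x_S)` times the fluxes of `y`. It vanishes for Crouzeix--Raviart
`v` and Raviart--Thomas `y` (`Triangulation.parts`), and testing with the function, respectively the
field, supported near one side gives the converse (`Triangulation.isRT_of_orthogonal` and
`Triangulation.isCR_of_orthogonal`).

Integrating the Fenchel--Young inequality then gives weak duality (`Triangulation.dual_le_primal`). If
`u` minimizes the primal functional, its Euler--Lagrange equation says that `a_T = Dφ(∇u_T)`,
`b_T = D g_T(u_T(x_T)) / d`, with `g_T` the common value of `ψ(x, ·)` on `T`, is orthogonal to the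
Crouzeix--Raviart space, hence defines a field `z` in the Raviart--Thomas space; equality in the
Fenchel--Young inequality (`conj_D`) shows that `u` and `z` have the same energy, so that `z` is a
maximizer by weak duality. The second part is the same argument with the roles exchanged; there
equality in the Fenchel--Young inequality is an instance of the Fenchel--Moreau theorem, proved in
`apply_D_conj` by separation from the epigraph.

The geometry of conforming triangulations is used through three facts. The vectors
`-|T| ∇λ_T`, with `λ_T` the barycentric coordinate of the vertex opposite to `S`, are opposite for the two
elements sharing `S` (`Triangulation.sideVec_neighbour`), which also shows that there are at most two
such elements. The mean value of an affine function is its value at the barycenter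
(`IsCell.average_affine`). Boundary sides lie in the boundary of the domain
(`Triangulation.boundarySide_subset_frontier`), so that they are contained in `ΓD` or meet `ΓN`.
-/

open MeasureTheory Set

namespace Marini

/-! ### Convex conjugates -/

section Convex

variable {H : Type*} [NormedAddCommGroup H] [InnerProductSpace ℝ H]

/-- A convex function lies above its tangent planes. -/
lemma tangent_le [CompleteSpace H] {f : H → ℝ} (hf : ConvexOn ℝ univ f) {x g : H}
    (h : HasGradientAt f g x) (y : H) : f x + inner ℝ g (y - x) ≤ f y := by
  have hA : ConvexOn ℝ univ (f ∘ AffineMap.lineMap (k := ℝ) x y) := by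
    simpa using hf.comp_affineMap (AffineMap.lineMap (k := ℝ) x y)
  have hd : HasDerivAt (f ∘ AffineMap.lineMap (k := ℝ) x y) (inner ℝ g (y - x)) 0 := by
    have h1 : HasFDerivAt f ((InnerProductSpace.toDual ℝ H) g) (AffineMap.lineMap x y (0 : ℝ)) := by
      simpa using h.hasFDerivAt
    simpa using h1.comp_hasDerivAt (0 : ℝ) AffineMap.hasDerivAt_lineMap
  have := hA.le_slope_of_hasDerivAt (mem_univ 0) (mem_univ 1) one_pos hd
  simp [slope_def_field] at this
  linarith

lemma conj_le_coe {f : H → EReal} (hf : ∀ x, f x ≠ ⊥) {y : H} {s : ℝ} :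
    conj f y ≤ s ↔ ∀ x (r : ℝ), f x = r → inner ℝ y x - r ≤ s := by
  unfold conj
  rw [iSup_le_iff]
  refine forall_congr' fun x => ?_
  induction h : f x using EReal.rec with
  | bot => exact absurd h (hf x)
  | top => simp
  | coe r =>
    constructor
    · intro h' r' hr
      rw [← EReal.coe_eq_coe_iff.1 hr]
      exact_mod_cast h'
    · intro h'
      exact_mod_cast h' r rfl

lemma conj_ne_bot {f : H → EReal} (hf : ProperConvexLSC f) (y : H) : conj f y ≠ ⊥ := by
  obtain ⟨x, hx⟩ := hf.exists_ne_top
  have h : ((inner ℝ y x : ℝ) : EReal) - f x ≤ conj f y :=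
    le_iSup (fun x => ((inner ℝ y x : ℝ) : EReal) - f x) x
  intro hb
  rw [hb, le_bot_iff] at h
  lift f x to ℝ using ⟨hx, hf.ne_bot x⟩ with r
  exact EReal.coe_ne_bot _ (by exact_mod_cast h)

/-- The Fenchel--Young inequality. -/
lemma inner_le_add {f : H → EReal} (hf : ∀ x, f x ≠ ⊥) {x y : H} {r s : ℝ} (hr : f x = r)
    (hs : conj f y = s) : inner ℝ y x ≤ r + s := by
  have := (conj_le_coe hf).1 hs.le x r hr
  linarith

lemma IsC1.coe_toReal {f : H → EReal} (hf : IsC1 f) (x : H) : ((f x).toReal : EReal) = f x :=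
  EReal.coe_toReal (hf.1 x).1 (hf.1 x).2

lemma IsC1.hasGradientAt [CompleteSpace H] {f : H → EReal} (hf : IsC1 f) (x : H) :
    HasGradientAt (fun x => (f x).toReal) (D f x) x :=
  ((hf.2.differentiable (by norm_num)) x).hasGradientAt

lemma ProperConvexLSC.convexOn {f : H → EReal} (hf : ProperConvexLSC f) (h1 : IsC1 f) :
    ConvexOn ℝ univ (fun x => (f x).toReal) := by
  refine ⟨convex_univ, fun x _ y _ a b ha hb hab => ?_⟩
  have := hf.convex (x := (x, (f x).toReal)) (by simp [h1.coe_toReal])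
    (y := (y, (f y).toReal)) (by simp [h1.coe_toReal]) ha hb hab
  simp only [mem_ofPred_eq, Prod.fst_add, Prod.smul_fst, Prod.snd_add, Prod.smul_snd] at this
  rw [← h1.coe_toReal] at this
  exact_mod_cast this

lemma convexOn_conj {f : H → EReal} (hf : ProperConvexLSC f) (h1 : IsC1 (conj f)) :
    ConvexOn ℝ univ (fun x => (conj f x).toReal) := by
  refine ⟨convex_univ, fun x _ y _ a b ha hb hab => ?_⟩
  have : conj f (a • x + b • y) ≤ ((a • (conj f x).toReal + b • (conj f y).toReal : ℝ) : EReal) := by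
    rw [conj_le_coe hf.ne_bot]
    intro z r hr
    have e1 := inner_le_add hf.ne_bot hr (h1.coe_toReal x).symm
    have e2 := inner_le_add hf.ne_bot hr (h1.coe_toReal y).symm
    rw [inner_add_left, inner_smul_left, inner_smul_left]
    simp only [conj_trivial, smul_eq_mul]
    obtain rfl : b = 1 - a := by linarith
    nlinarith [mul_le_mul_of_nonneg_left e1 ha, mul_le_mul_of_nonneg_left e2 hb]
  rw [← h1.coe_toReal] at this
  exact_mod_cast this

/-- Equality in the Fenchel--Young inequality at `(x, Df(x))`. -/
lemma conj_D [CompleteSpace H] {f : H → EReal} (hf : ProperConvexLSC f) (h1 : IsC1 f) (x : H) :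
    conj f (D f x) = ((inner ℝ (D f x) x - (f x).toReal : ℝ) : EReal) := by
  apply le_antisymm
  · rw [conj_le_coe hf.ne_bot]
    intro y r hr
    have := tangent_le (hf.convexOn h1) (h1.hasGradientAt x) y
    rw [hr, EReal.toReal_coe, inner_sub_right] at this
    linarith
  · refine le_trans ?_ (le_iSup (fun z => ((inner ℝ (D f x) z : ℝ) : EReal) - f z) x)
    rw [← h1.coe_toReal x]
    simp

/-- Equality in the Fenchel--Young inequality at `(Df*(a), a)`. This is the case of the
Fenchel--Moreau theorem `f = f**` at a subgradient of a finite conjugate, obtained by separating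
`(q, ⟨a, q⟩ - f*(a))`, `q = Df*(a)`, from the epigraph of `f`. -/
lemma apply_D_conj [CompleteSpace H] {f : H → EReal} (hf : ProperConvexLSC f)
    (h1 : IsC1 (conj f)) (a : H) :
    f (D (conj f) a) = ((inner ℝ a (D (conj f) a) - (conj f a).toReal : ℝ) : EReal) := by
  set q := D (conj f) a with hq
  set r : ℝ := inner ℝ a q - (conj f a).toReal with hr
  have tang : ∀ y, (conj f a).toReal + inner ℝ q (y - a) ≤ (conj f y).toReal :=
    tangent_le (convexOn_conj hf h1) (h1.hasGradientAt a)
  have key : f q ≤ (r : EReal) := by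
    by_contra hn
    have hclosed : IsClosed {p : H × ℝ | f p.1 ≤ (p.2 : EReal)} :=
      hf.lsc.isClosed_epigraph.preimage
        (continuous_fst.prodMk (continuous_coe_real_ereal.comp continuous_snd))
    obtain ⟨L, u, hu, hL⟩ := geometric_hahn_banach_point_closed hf.convex hclosed
      (x := (q, r)) hn
    set β := L (0, 1) with hβ
    set w : H := (InnerProductSpace.toDual ℝ H).symm (L.comp (ContinuousLinearMap.inl ℝ H ℝ))
      with hw
    have hLe : ∀ x t, L (x, t) = inner ℝ w x + β * t := by
      intro x t
      have : (x, t) = (x, (0 : ℝ)) + t • ((0 : H), (1 : ℝ)) := by simp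
      rw [this, map_add, map_smul, hw, InnerProductSpace.toDual_symm_apply]
      simp [hβ, mul_comm]
    have hepi : ∀ x (ρ : ℝ), f x ≤ ρ → u < inner ℝ w x + β * ρ := by
      intro x ρ h
      rw [← hLe]
      exact hL (x, ρ) h
    rw [hLe] at hu
    have hβ0 : 0 ≤ β := by
      by_contra hneg
      push Not at hneg
      obtain ⟨x, hx⟩ := hf.exists_ne_top
      have e1 := EReal.coe_toReal hx (hf.ne_bot x)
      set ρ := (f x).toReal
      set t : ℝ := max ρ ((u - inner ℝ w x) / β)
      have e2 := hepi x t (by rw [← e1]; exact_mod_cast le_max_left _ _)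
      have e3 : (u - inner ℝ w x) / β ≤ t := le_max_right _ _
      rw [div_le_iff_of_neg hneg] at e3
      linarith
    rcases hβ0.eq_or_lt with h0 | hpos
    · -- a vertical hyperplane would force `f*` below its tangent plane at `a - w`
      have e1 : conj f (a - w) ≤ (((conj f a).toReal - u : ℝ) : EReal) := by
        rw [conj_le_coe hf.ne_bot]
        intro x ρ hρ
        have e2 := hepi x ρ hρ.le
        have e3 := inner_le_add hf.ne_bot hρ (h1.coe_toReal a).symm
        rw [inner_sub_left]
        rw [← h0] at e2
        linarith
      rw [← h1.coe_toReal (a - w)] at e1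
      have e1' : (conj f (a - w)).toReal ≤ (conj f a).toReal - u := by exact_mod_cast e1
      have e4 := tang (a - w)
      simp only [sub_sub_cancel_left, inner_neg_right] at e4
      rw [real_inner_comm] at e4
      rw [← h0] at hu
      linarith
    · have e1 : conj f (-(β⁻¹ • w)) ≤ ((-(u / β) : ℝ) : EReal) := by
        rw [conj_le_coe hf.ne_bot]
        intro x ρ hρ
        have e2 := hepi x ρ hρ.le
        rw [inner_neg_left, real_inner_smul_left]
        have e3 : u / β ≤ (inner ℝ w x + β * ρ) / β := by gcongr
        have e4 : (inner ℝ w x + β * ρ) / β = β⁻¹ * inner ℝ w x + ρ := by field_simp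
        linarith
      rw [← h1.coe_toReal] at e1
      have e1' : (conj f (-(β⁻¹ • w))).toReal ≤ -(u / β) := by exact_mod_cast e1
      have e4 := tang (-(β⁻¹ • w))
      rw [inner_sub_right, inner_neg_right, real_inner_smul_right, real_inner_comm w q,
        real_inner_comm a q] at e4
      have e5 : (inner ℝ w q + β * r) / β < u / β := by gcongr
      have e6 : (inner ℝ w q + β * r) / β = β⁻¹ * inner ℝ w q + r := by field_simp
      linarith
  refine le_antisymm key ?_
  have hfq : f q ≠ ⊤ := fun h => by rw [h, top_le_iff] at key; exact EReal.coe_ne_top _ key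
  have e1 := EReal.coe_toReal hfq (hf.ne_bot q)
  have e2 := inner_le_add hf.ne_bot e1.symm (h1.coe_toReal a).symm
  rw [← e1]
  exact_mod_cast (by linarith : r ≤ (f q).toReal)

end Convex

/-! ### Barycentric coordinates of a simplex -/

variable {d : ℕ}

/-- The finite set `T` is the set of vertices of a non-degenerate `d`-simplex in `ℝ^d`. -/
structure IsCell (T : Finset (E d)) : Prop where
  indep : AffineIndependent ℝ ((↑) : T → E d)
  card : T.card = d + 1

/-- The vertices of a cell as an affine basis of `ℝ^d`. -/
noncomputable def IsCell.basis {T : Finset (E d)} (hT : IsCell T) : AffineBasis T ℝ (E d) :=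
  ⟨(↑), hT.indep, by
    rw [hT.indep.affineSpan_eq_top_iff_card_eq_finrank_add_one]
    simp [hT.card]⟩

open Classical in
/-- The barycentric coordinate of the cell `T` that is one at the vertex `z` and zero at the other
vertices; the zero function if `T` is not a cell or `z` is not a vertex of `T`. -/
noncomputable def bary (T : Finset (E d)) (z : E d) : E d →ᵃ[ℝ] ℝ :=
  if h : IsCell T ∧ z ∈ T then h.1.basis.coord ⟨z, h.2⟩ else 0

/-- The constant gradient of an affine function. -/
noncomputable def agrad (p : E d →ᵃ[ℝ] ℝ) : E d :=
  (InnerProductSpace.toDual ℝ (E d)).symm (LinearMap.toContinuousLinearMap p.linear)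

lemma inner_agrad (p : E d →ᵃ[ℝ] ℝ) (v : E d) : inner ℝ (agrad p) v = p.linear v := by
  simp [agrad]

lemma inner_agrad_sub (p : E d →ᵃ[ℝ] ℝ) (x y : E d) : inner ℝ (agrad p) (x - y) = p x - p y := by
  rw [inner_agrad]
  exact (p.linearMap_vsub x y)

lemma affine_apply {F : Type*} [AddCommGroup F] [Module ℝ F] (p : E d →ᵃ[ℝ] F) (x : E d) :
    p x = p.linear x + p 0 := by
  have := p.map_vadd 0 x
  simpa using this

lemma hasFDerivAt_affine {F : Type*} [NormedAddCommGroup F] [NormedSpace ℝ F] (p : E d →ᵃ[ℝ] F)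
    (x : E d) : HasFDerivAt p (LinearMap.toContinuousLinearMap p.linear) x := by
  have h := (LinearMap.toContinuousLinearMap p.linear).hasFDerivAt (x := x) |>.add_const (p 0)
  exact h.congr_of_eventuallyEq (Filter.Eventually.of_forall fun y => affine_apply p y)

lemma hasGradientAt_affine (p : E d →ᵃ[ℝ] ℝ) (x : E d) : HasGradientAt p (agrad p) x := by
  rw [hasGradientAt_iff_hasFDerivAt, agrad, LinearIsometryEquiv.apply_symm_apply]
  exact hasFDerivAt_affine p x

/-- The barycenter of the cell `T`. -/
noncomputable def center (T : Finset (E d)) : E d := ((d : ℝ) + 1)⁻¹ • ∑ z ∈ T, z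

lemma affine_smul_sum {F : Type*} [AddCommGroup F] [Module ℝ F] (p : E d →ᵃ[ℝ] F)
    (s : Finset (E d)) (c : ℝ) (h : c * s.card = 1) :
    p (c • ∑ z ∈ s, z) = c • ∑ z ∈ s, p z := by
  rw [affine_apply, Finset.sum_congr rfl (fun z _ => affine_apply p z)]
  rw [Finset.sum_add_distrib, map_smul, map_sum, smul_add, Finset.sum_const, ← Nat.cast_smul_eq_nsmul ℝ,
    smul_smul, h, one_smul]

lemma affine_barycenter {F : Type*} [AddCommGroup F] [Module ℝ F] (hd : 1 ≤ d) (p : E d →ᵃ[ℝ] F)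
    {S : Finset (E d)} (hS : S.card = d) :
    p (Triangulation.barycenter S) = (d : ℝ)⁻¹ • ∑ z ∈ S, p z := by
  apply affine_smul_sum
  rw [hS, inv_mul_cancel₀]
  positivity

namespace IsCell

variable {T : Finset (E d)} (hT : IsCell T)
include hT

lemma bary_eq {z : E d} (hz : z ∈ T) : bary T z = hT.basis.coord ⟨z, hz⟩ := by
  simp [bary, hT, hz]

lemma bary_self {z : E d} (hz : z ∈ T) : bary T z z = 1 := by
  rw [hT.bary_eq hz]
  exact hT.basis.coord_apply_eq ⟨z, hz⟩

lemma bary_of_ne {z w : E d} (hz : z ∈ T) (hw : w ∈ T) (h : w ≠ z) : bary T z w = 0 := by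
  rw [hT.bary_eq hz]
  exact hT.basis.coord_apply_ne (i := ⟨z, hz⟩) (j := ⟨w, hw⟩) (by simpa using h.symm)

lemma sum_bary (x : E d) : ∑ z ∈ T, bary T z x = 1 := by
  rw [← hT.basis.sum_coord_apply_eq_one x, ← Finset.sum_coe_sort]
  exact Finset.sum_congr rfl fun z _ => by rw [hT.bary_eq z.2]

lemma sum_bary_smul (x : E d) : ∑ z ∈ T, bary T z x • z = x := by
  conv_rhs => rw [← hT.basis.linear_combination_coord_eq_self x]
  rw [← Finset.sum_coe_sort]
  exact Finset.sum_congr rfl fun z _ => by rw [hT.bary_eq z.2]; rfl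

lemma affine_eq_sum {F : Type*} [AddCommGroup F] [Module ℝ F] (p : E d →ᵃ[ℝ] F) (x : E d) :
    p x = ∑ z ∈ T, bary T z x • p z := by
  have h : ∑ z ∈ T, bary T z x • p z = ∑ z ∈ T, (p.linear (bary T z x • z) + bary T z x • p 0) :=
    Finset.sum_congr rfl fun z _ => by rw [affine_apply p z, smul_add, map_smul]
  rw [h, Finset.sum_add_distrib, ← Finset.sum_smul, hT.sum_bary, one_smul, ← map_sum,
    hT.sum_bary_smul, ← affine_apply]

lemma affine_ext {F : Type*} [AddCommGroup F] [Module ℝ F] {p q : E d →ᵃ[ℝ] F}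
    (h : ∀ z ∈ T, p z = q z) : p = q := by
  ext x
  rw [hT.affine_eq_sum p, hT.affine_eq_sum q]
  exact Finset.sum_congr rfl fun z hz => by rw [h z hz]

lemma range_basis : range hT.basis = (T : Set (E d)) := by
  show range ((↑) : T → E d) = _
  simp

lemma mem_hull_iff {x : E d} :
    x ∈ convexHull ℝ (T : Set (E d)) ↔ ∀ z ∈ T, 0 ≤ bary T z x := by
  rw [← hT.range_basis, hT.basis.convexHull_eq_nonneg_coord]
  simp only [mem_ofPred_eq, Subtype.forall]
  exact forall₂_congr fun z hz => by rw [hT.bary_eq hz]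

lemma mem_interior_iff {x : E d} :
    x ∈ interior (convexHull ℝ (T : Set (E d))) ↔ ∀ z ∈ T, 0 < bary T z x := by
  rw [← hT.range_basis, hT.basis.interior_convexHull]
  simp only [mem_ofPred_eq, Subtype.forall]
  exact forall₂_congr fun z hz => by rw [hT.bary_eq hz]

lemma affine_center {F : Type*} [AddCommGroup F] [Module ℝ F] (p : E d →ᵃ[ℝ] F) :
    p (center T) = ((d : ℝ) + 1)⁻¹ • ∑ z ∈ T, p z := by
  apply affine_smul_sum
  rw [hT.card]
  push_cast
  rw [inv_mul_cancel₀]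
  positivity

lemma sum_bary_vertex {z : E d} (hz : z ∈ T) : ∑ w ∈ T, bary T z w = 1 := by
  rw [Finset.sum_eq_single_of_mem z hz fun w hw h => hT.bary_of_ne hz hw h, hT.bary_self hz]

lemma bary_center {z : E d} (hz : z ∈ T) : bary T z (center T) = ((d : ℝ) + 1)⁻¹ := by
  rw [hT.affine_center, hT.sum_bary_vertex hz]
  simp

lemma center_mem_interior : center T ∈ interior (convexHull ℝ (T : Set (E d))) := by
  rw [hT.mem_interior_iff]
  intro z hz
  rw [hT.bary_center hz]
  positivity

/-- `d · p(x_S) = (d + 1) · p(x_T) - p(z)` for the side `S` of `T` opposite to `z`. -/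
lemma affine_barycenter_erase {F : Type*} [AddCommGroup F] [Module ℝ F] (hd : 1 ≤ d)
    (p : E d →ᵃ[ℝ] F) {z : E d} (hz : z ∈ T) :
    (d : ℝ) • p (Triangulation.barycenter (T.erase z))
      = ((d : ℝ) + 1) • p (center T) - p z := by
  have hd' : (d : ℝ) ≠ 0 := by positivity
  have hd'' : (d : ℝ) + 1 ≠ 0 := by positivity
  rw [affine_barycenter hd p (by rw [Finset.card_erase_of_mem hz, hT.card]; rfl),
    hT.affine_center, smul_inv_smul₀ hd', smul_inv_smul₀ hd'',
    ← Finset.add_sum_erase T (fun z => p z) hz]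
  abel

lemma bary_eq_zero_of_mem {z x : E d} {S : Finset (E d)} (hz : z ∈ T) (hS : S ⊆ T) (hzS : z ∉ S)
    (hx : x ∈ convexHull ℝ (S : Set (E d))) : bary T z x = 0 := by
  have h1 : convexHull ℝ (S : Set (E d)) ⊆ bary T z ⁻¹' {0} := by
    apply convexHull_min
    · intro w hw
      exact hT.bary_of_ne hz (hS hw) (fun h => hzS (h ▸ hw))
    · exact (convex_singleton (0 : ℝ)).affine_preimage _
  exact h1 hx

lemma sum_agrad_bary_smul (p : E d →ᵃ[ℝ] ℝ) : ∑ z ∈ T, p z • agrad (bary T z) = agrad p := by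
  apply ext_inner_right ℝ
  intro v
  rw [sum_inner]
  simp_rw [real_inner_smul_left]
  have h : ∀ q : E d →ᵃ[ℝ] ℝ, inner ℝ (agrad q) v = q v - q 0 := fun q => by
    rw [← inner_agrad_sub, sub_zero]
  simp_rw [h, mul_sub]
  rw [Finset.sum_sub_distrib, hT.affine_eq_sum p v, hT.affine_eq_sum p 0]
  simp [mul_comm]

lemma sum_agrad_bary : ∑ z ∈ T, agrad (bary T z) = 0 := by
  have := hT.sum_agrad_bary_smul (AffineMap.const ℝ (E d) (1 : ℝ))
  simp only [AffineMap.const_apply, one_smul] at this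
  rw [this]
  simp [agrad]

lemma agrad_bary_ne_zero (hd : 1 ≤ d) {z : E d} (hz : z ∈ T) : agrad (bary T z) ≠ 0 := by
  intro h
  obtain ⟨w, hw, hwz⟩ := Finset.exists_mem_ne (s := T) (by rw [hT.card]; omega) z
  have := inner_agrad_sub (bary T z) z w
  rw [h, hT.bary_self hz, hT.bary_of_ne hz hw hwz] at this
  simp at this

/-- The element-wise integration by parts formula: for `y = a + b (x - x_T)` and an affine `p`, the
integral of `⟨y, ∇p⟩ + p div y` over `T`, divided by `|T|`, as a sum over the sides. -/
lemma local_parts (hd : 1 ≤ d) (p : E d →ᵃ[ℝ] ℝ) (a : E d) (b : ℝ) :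
    inner ℝ a (agrad p) + d * b * p (center T)
      = -∑ z ∈ T, p (Triangulation.barycenter (T.erase z)) *
          (d * (inner ℝ a (agrad (bary T z)) - b * ((d : ℝ) + 1)⁻¹)) := by
  have h1 : ∀ z ∈ T, p (Triangulation.barycenter (T.erase z)) *
          (d * (inner ℝ a (agrad (bary T z)) - b * ((d : ℝ) + 1)⁻¹))
        = (((d : ℝ) + 1) * p (center T)) * inner ℝ a (agrad (bary T z))
          - p z * inner ℝ a (agrad (bary T z))
          - b * p (center T) + ((d : ℝ) + 1)⁻¹ * b * p z := by
    intro z hz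
    have := hT.affine_barycenter_erase hd p hz
    simp only [smul_eq_mul] at this
    have hd'' : (d : ℝ) + 1 ≠ 0 := by positivity
    field_simp
    linear_combination (inner ℝ a (agrad (bary T z)) * (d + 1) - b) * this
  rw [Finset.sum_congr rfl h1]
  rw [Finset.sum_add_distrib, Finset.sum_sub_distrib, Finset.sum_sub_distrib, ← Finset.mul_sum,
    ← Finset.mul_sum, ← inner_sum, hT.sum_agrad_bary, inner_zero_right]
  have h2 : ∑ z ∈ T, p z * inner ℝ a (agrad (bary T z)) = inner ℝ a (agrad p) := by
    rw [← hT.sum_agrad_bary_smul p, inner_sum]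
    simp_rw [real_inner_smul_right]
  have h3 := hT.affine_center p
  have h4 : ∑ z ∈ T, ((d : ℝ) + 1)⁻¹ * b * p z = b * p (center T) := by
    rw [← Finset.mul_sum, h3, smul_eq_mul]
    ring
  rw [h2, h4, Finset.sum_const, hT.card]
  simp only [nsmul_eq_mul]
  push_cast
  ring

/-- An affine vector field with constant normal components on the sides of `T` is of the form
`a + b (x - x_T)`: by the hypothesis its linear part maps each edge of `T` to a multiple of itself,
and the factor is the same for all edges. -/
lemma rt_form (hd : 1 ≤ d) (q : E d →ᵃ[ℝ] E d)
    (hq : ∀ z ∈ T, ∀ x ∈ T.erase z, ∀ y ∈ T.erase z,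
      inner ℝ (q x - q y) (agrad (bary T z)) = 0) :
    ∃ b : ℝ, ∀ x, q x = q (center T) + b • (x - center T) := by
  classical
  obtain ⟨z0, hz0⟩ : T.Nonempty := by rw [← Finset.card_pos, hT.card]; omega
  have expand : ∀ v : E d, v = ∑ k ∈ T, (inner ℝ v (agrad (bary T k)) : ℝ) • k := by
    intro v
    have e : ∀ k ∈ T, (inner ℝ v (agrad (bary T k)) : ℝ) • k = bary T k v • k - bary T k 0 • k := by
      intro k _
      rw [← sub_smul, ← inner_agrad_sub, sub_zero, real_inner_comm]
    rw [Finset.sum_congr rfl e, Finset.sum_sub_distrib, hT.sum_bary_smul, hT.sum_bary_smul, sub_zero]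
  have sum0 : ∀ v : E d, ∑ k ∈ T, (inner ℝ v (agrad (bary T k)) : ℝ) = 0 := by
    intro v
    rw [← inner_sum, hT.sum_agrad_bary, inner_zero_right]
  -- the edges at `z0` are eigenvectors of the linear part
  have edge : ∀ i ∈ T, i ≠ z0 →
      q i - q z0 = (inner ℝ (q i - q z0) (agrad (bary T i)) : ℝ) • (i - z0) := by
    intro i hi hne
    have hz : ∀ k ∈ (T.erase z0).erase i, (inner ℝ (q i - q z0) (agrad (bary T k)) : ℝ) = 0 := by
      intro k hk
      simp only [Finset.mem_erase] at hk
      exact hq k hk.2.2 i (by simp [hi, Ne.symm hk.1]) z0 (by simp [hz0, Ne.symm hk.2.1])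
    have h1 := sum0 (q i - q z0)
    have h2 := expand (q i - q z0)
    have hi' : i ∈ T.erase z0 := by simp [hi, hne]
    rw [← Finset.add_sum_erase _ _ hz0, ← Finset.add_sum_erase _ _ hi', Finset.sum_eq_zero hz] at h1
    rw [← Finset.add_sum_erase _ _ hz0, ← Finset.add_sum_erase _ _ hi',
      Finset.sum_eq_zero (fun k hk => by rw [hz k hk, zero_smul])] at h2
    have h3 : (inner ℝ (q i - q z0) (agrad (bary T z0)) : ℝ)
        = -(inner ℝ (q i - q z0) (agrad (bary T i)) : ℝ) := by linarith
    rw [h3] at h2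
    conv_lhs => rw [h2]
    module
  obtain ⟨i0, hi0, hi0z⟩ := Finset.exists_mem_ne (s := T) (by rw [hT.card]; omega) z0
  set b : ℝ := inner ℝ (q i0 - q z0) (agrad (bary T i0)) with hb
  have same : ∀ i ∈ T, i ≠ z0 → q i - q z0 = b • (i - z0) := by
    intro i hi hne
    have h0 := hq z0 hz0 i (by simp [hi, hne]) i0 (by simp [hi0, hi0z])
    have h1 : q i - q i0 = (inner ℝ (q i - q z0) (agrad (bary T i)) : ℝ) • (i - z0)
        - b • (i0 - z0) := by
      rw [← edge i hi hne, hb, ← edge i0 hi0 hi0z]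
      abel
    rw [h1, inner_sub_left, real_inner_smul_left, real_inner_smul_left,
      real_inner_comm _ (i - z0), real_inner_comm _ (i0 - z0), inner_agrad_sub, inner_agrad_sub,
      hT.bary_self hz0, hT.bary_of_ne hz0 hi hne, hT.bary_of_ne hz0 hi0 hi0z] at h0
    rw [edge i hi hne]
    congr 1
    linarith
  have all : q = AffineMap.const ℝ (E d) (q z0) + b • (AffineMap.id ℝ (E d)
      - AffineMap.const ℝ (E d) z0) := by
    apply hT.affine_ext
    intro i hi
    by_cases hne : i = z0
    · subst hne; simp
    · simp [← same i hi hne]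
  refine ⟨b, fun x => ?_⟩
  have e : ∀ x, q x = q z0 + b • (x - z0) := fun x => by
    conv_lhs => rw [all]
    simp
  rw [e x, e (center T)]
  module

end IsCell

/-! ### Volumes and mean values of simplices -/

/-- The affine map `x ↦ x + f(x) w`. -/
noncomputable def shear (f : E d →ᵃ[ℝ] ℝ) (w : E d) : E d →ᵃ[ℝ] E d :=
  AffineMap.id ℝ (E d) + (LinearMap.toSpanSingleton ℝ (E d) w).toAffineMap.comp f

lemma shear_apply (f : E d →ᵃ[ℝ] ℝ) (w x : E d) : shear f w x = x + f x • w := by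
  simp [shear]

lemma setIntegral_shear_image {F : Type*} [NormedAddCommGroup F] [NormedSpace ℝ F]
    (f : E d →ᵃ[ℝ] ℝ) (w : E d) (hδ : 1 + f.linear w ≠ 0)
    {s : Set (E d)} (hs : MeasurableSet s) (g : E d → F) :
    ∫ x in shear f w '' s, g x = |1 + f.linear w| • ∫ x in s, g (shear f w x) := by
  have hlin : (shear f w).linear = LinearMap.transvection f.linear w := by
    ext1 x
    simp [shear, LinearMap.transvection]
  have hinj : Function.Injective (shear f w) := by
    intro x y hxy
    rw [shear_apply, shear_apply] at hxy
    have hsub : f x - f y = f.linear (x - y) := (f.linearMap_vsub x y).symm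
    have h1 : (x - y) + f.linear (x - y) • w = 0 := by
      rw [← hsub, sub_smul, ← sub_eq_zero.2 hxy]
      abel
    have h2 := congrArg f.linear h1
    rw [map_add, map_smul, map_zero, smul_eq_mul] at h2
    have h3 : f.linear (x - y) = 0 := by
      have : f.linear (x - y) * (1 + f.linear w) = 0 := by linear_combination h2
      exact (mul_eq_zero.1 this).resolve_right hδ
    rw [h3, zero_smul, add_zero] at h1
    exact sub_eq_zero.1 h1
  rw [integral_image_eq_integral_abs_det_fderiv_smul volume hs
    (fun x _ => (hasFDerivAt_affine (shear f w) x).hasFDerivWithinAt) hinj.injOn]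
  have hdet : (LinearMap.toContinuousLinearMap (shear f w).linear).det = 1 + f.linear w := by
    rw [LinearMap.det_toContinuousLinearMap, hlin, LinearMap.transvection.det]
  rw [hdet, integral_smul]

/-- The volume of the simplex with vertices `T`. -/
noncomputable def vol (T : Finset (E d)) : ℝ := volume.real (convexHull ℝ (T : Set (E d)))

lemma isCompact_hull (T : Finset (E d)) : IsCompact (convexHull ℝ (T : Set (E d))) :=
  T.finite_toSet.isCompact_convexHull ℝ

lemma measure_hull_ne_top (T : Finset (E d)) : volume (convexHull ℝ (T : Set (E d))) ≠ ⊤ :=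
  (isCompact_hull T).measure_lt_top.ne

lemma ae_eq_interior (T : Finset (E d)) :
    interior (convexHull ℝ (T : Set (E d))) =ᵐ[volume] convexHull ℝ (T : Set (E d)) :=
  interior_ae_eq_of_null_frontier ((convex_convexHull ℝ _).addHaar_frontier volume)

lemma measure_interior (T : Finset (E d)) :
    volume (interior (convexHull ℝ (T : Set (E d)))) = ENNReal.ofReal (vol T) := by
  rw [measure_congr (ae_eq_interior T), vol, Measure.real, ENNReal.ofReal_toReal (measure_hull_ne_top T)]

lemma integrableOn_affine {F : Type*} [NormedAddCommGroup F] [NormedSpace ℝ F] (T : Finset (E d))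
    (p : E d →ᵃ[ℝ] F) : IntegrableOn p (convexHull ℝ (T : Set (E d))) := by
  have hc : Continuous p := continuous_iff_continuousAt.2 fun x => (hasFDerivAt_affine p x).continuousAt
  exact hc.continuousOn.integrableOn_compact (isCompact_hull T)

namespace IsCell

variable {T : Finset (E d)} (hT : IsCell T)
include hT

lemma vol_pos : 0 < vol T := by
  have h : 0 < volume (interior (convexHull ℝ (T : Set (E d)))) :=
    isOpen_interior.measure_pos volume ⟨_, hT.center_mem_interior⟩
  rw [measure_interior] at h
  exact ENNReal.ofReal_pos.1 h

/-- The volume of a simplex depends on a vertex as the absolute value of the corresponding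
barycentric coordinate. -/
lemma vol_of_common_side {S : Finset (E d)} {z z' : E d}
    (hTS : T = insert z S) (hz : z ∉ S)
    (h0 : bary T z z' ≠ 0) : vol (insert z' S) = |bary T z z'| * vol T := by
  have hzT : z ∈ T := by simp [hTS]
  have hlin : 1 + (bary T z).linear (z' - z) = bary T z z' := by
    rw [← inner_agrad, inner_agrad_sub, hT.bary_self hzT]
    ring
  have himg : shear (bary T z) (z' - z) '' (T : Set (E d)) = ((insert z' S : Finset (E d)) : Set (E d)) := by
    rw [hTS, Finset.coe_insert, Finset.coe_insert, image_insert_eq, ← hTS]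
    congr 1
    · rw [shear_apply, hT.bary_self hzT]
      simp
    · refine (image_congr (g := id) fun w hw => ?_).trans (image_id _)
      rw [shear_apply, hT.bary_of_ne hzT (by rw [hTS]; simp_all) (fun h => hz (h ▸ hw))]
      simp
  have h := setIntegral_shear_image (bary T z) (z' - z) (by rwa [hlin])
    (isCompact_hull T).measurableSet (fun _ => (1 : ℝ))
  rw [AffineMap.image_convexHull, himg, hlin] at h
  simpa [vol] using h

/-- All barycentric coordinates have the same integral, since the affine map that exchanges two
vertices preserves the simplex and its determinant is `-1`. -/
lemma setIntegral_bary_eq {z w : E d} (hz : z ∈ T) (hw : w ∈ T) :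
    ∫ x in convexHull ℝ (T : Set (E d)), bary T z x
      = ∫ x in convexHull ℝ (T : Set (E d)), bary T w x := by
  classical
  by_cases hzw : z = w
  · rw [hzw]
  set f := bary T z - bary T w with hf
  have fz : f z = 1 := by simp [hf, hT.bary_self hz, hT.bary_of_ne hw hz hzw]
  have fw : f w = -1 := by simp [hf, hT.bary_self hw, hT.bary_of_ne hz hw (Ne.symm hzw)]
  have fv : ∀ v ∈ T, v ≠ z → v ≠ w → f v = 0 := fun v hv h1 h2 => by
    simp [hf, hT.bary_of_ne hz hv h1, hT.bary_of_ne hw hv h2]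
  have Fz : shear f (w - z) z = w := by rw [shear_apply, fz]; simp
  have Fw : shear f (w - z) w = z := by rw [shear_apply, fw]; simp
  have Fv : ∀ v ∈ T, v ≠ z → v ≠ w → shear f (w - z) v = v := fun v hv h1 h2 => by
    rw [shear_apply, fv v hv h1 h2]; simp
  have hlin : 1 + f.linear (w - z) = -1 := by
    rw [← inner_agrad, inner_agrad_sub, fz, fw]
    norm_num
  have himg : shear f (w - z) '' (T : Set (E d)) = T := by
    have hmaps : ∀ v ∈ T, shear f (w - z) v ∈ T ∧ shear f (w - z) (shear f (w - z) v) = v := by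
      intro v hv
      by_cases h1 : v = z
      · subst h1; rw [Fz, Fw]; exact ⟨hw, rfl⟩
      by_cases h2 : v = w
      · subst h2; rw [Fw, Fz]; exact ⟨hz, rfl⟩
      rw [Fv v hv h1 h2, Fv v hv h1 h2]; exact ⟨hv, rfl⟩
    ext v
    constructor
    · rintro ⟨u, hu, rfl⟩
      exact (hmaps u hu).1
    · exact fun hv => ⟨_, (hmaps v hv).1, (hmaps v hv).2⟩
  have hcomp : (bary T z).comp (shear f (w - z)) = bary T w := by
    apply hT.affine_ext
    intro v hv
    rw [AffineMap.comp_apply]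
    by_cases h1 : v = z
    · subst h1; rw [Fz, hT.bary_of_ne hz hw (Ne.symm hzw), hT.bary_of_ne hw hz hzw]
    by_cases h2 : v = w
    · subst h2; rw [Fw, hT.bary_self hz, hT.bary_self hw]
    rw [Fv v hv h1 h2, hT.bary_of_ne hz hv h1, hT.bary_of_ne hw hv h2]
  have h := setIntegral_shear_image f (w - z) (by rw [hlin]; norm_num)
    (isCompact_hull T).measurableSet (bary T z)
  rw [AffineMap.image_convexHull, himg, hlin] at h
  rw [h, ← hcomp]
  simp

lemma setIntegral_bary {z : E d} (hz : z ∈ T) :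
    ∫ x in convexHull ℝ (T : Set (E d)), bary T z x = ((d : ℝ) + 1)⁻¹ * vol T := by
  have h1 : ∑ w ∈ T, ∫ x in convexHull ℝ (T : Set (E d)), bary T w x = vol T := by
    rw [← integral_finsetSum _ fun w _ => integrableOn_affine T (bary T w)]
    simp_rw [hT.sum_bary]
    simp [vol]
  rw [Finset.sum_congr rfl fun w hw => hT.setIntegral_bary_eq hw hz, Finset.sum_const, hT.card] at h1
  rw [← h1]
  have : (d : ℝ) + 1 ≠ 0 := by positivity
  simp only [nsmul_eq_mul]
  push_cast
  field_simp

/-- The mean value of an affine function over a simplex is its value at the barycenter. -/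
lemma average_affine {F : Type*} [NormedAddCommGroup F] [NormedSpace ℝ F] [CompleteSpace F]
    (p : E d →ᵃ[ℝ] F) : ⨍ x in convexHull ℝ (T : Set (E d)), p x = p (center T) := by
  have h : ∫ x in convexHull ℝ (T : Set (E d)), p x = vol T • p (center T) := by
    have h1 : ∀ x, p x = ∑ z ∈ T, bary T z x • p z := fun x => hT.affine_eq_sum p x
    rw [integral_congr_ae (.of_forall h1), integral_finsetSum _ fun w _ => (integrableOn_affine T (bary T w)).smul_const _]
    simp_rw [integral_smul_const]
    rw [Finset.sum_congr rfl fun z hz => by rw [hT.setIntegral_bary hz], ← Finset.smul_sum,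
      mul_comm, mul_smul, ← hT.affine_center]
  rw [setAverage_eq, h, ← vol, inv_smul_smul₀ hT.vol_pos.ne']

end IsCell

/-! ### Sides and normals of a simplex -/

/-- The outward normal of the cell `T` on its side `S`, of length `|S| / d`: the product of `-|T|`
and the gradient of the barycentric coordinate of the vertex opposite to `S`. -/
noncomputable def sideVec (T S : Finset (E d)) : E d :=
  -vol T • ∑ z ∈ T \ S, agrad (bary T z)

/-- The flux, divided by `d`, of the vector field `a + b (x - x_T)` through the side `S` of `T`. -/
noncomputable def flux (T S : Finset (E d)) (a : E d) (b : ℝ) : ℝ :=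
  inner ℝ a (sideVec T S) + b * ((d : ℝ) + 1)⁻¹ * vol T

lemma sideVec_erase {T : Finset (E d)} {z : E d} (hz : z ∈ T) :
    sideVec T (T.erase z) = -vol T • agrad (bary T z) := by
  rw [sideVec, Finset.sdiff_erase_self hz, Finset.sum_singleton]

lemma flux_add_smul (T S : Finset (E d)) (a a' : E d) (b b' t : ℝ) :
    flux T S (a + t • a') (b + t * b') = flux T S a b + t * flux T S a' b' := by
  simp only [flux, inner_add_left, real_inner_smul_left]
  ring

lemma barycenter_mem (hd : 1 ≤ d) {S : Finset (E d)} (hS : S.card = d) :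
    Triangulation.barycenter S ∈ convexHull ℝ (S : Set (E d)) := by
  have hd' : (d : ℝ) ≠ 0 := by positivity
  rw [Triangulation.barycenter, Finset.smul_sum]
  refine (convex_convexHull ℝ _).sum_mem (fun _ _ => by positivity) ?_
    (fun z hz => subset_convexHull ℝ _ hz)
  simp [hS, hd']

lemma agrad_smul (c : ℝ) (p : E d →ᵃ[ℝ] ℝ) : agrad (c • p) = c • agrad p := by
  simp [agrad]

namespace IsCell

variable {T : Finset (E d)} (hT : IsCell T)
include hT

lemma exists_erase {S : Finset (E d)} (hS : S.card = d) (hST : S ⊆ T) :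
    ∃ z ∈ T, S = T.erase z := by
  have h1 : (T \ S).card = 1 := by rw [Finset.card_sdiff_of_subset hST, hT.card, hS]; omega
  obtain ⟨z, hz⟩ := Finset.card_eq_one.1 h1
  have hz' : z ∈ T \ S := by simp [hz]
  refine ⟨z, (Finset.mem_sdiff.1 hz').1, ?_⟩
  rw [Finset.erase_eq, ← hz, Finset.sdiff_sdiff_eq_self hST]

lemma card_erase {z : E d} (hz : z ∈ T) : (T.erase z).card = d := by
  rw [Finset.card_erase_of_mem hz, hT.card]; rfl

lemma sideVec_ne_zero (hd : 1 ≤ d) {S : Finset (E d)} (hS : S.card = d) (hST : S ⊆ T) :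
    sideVec T S ≠ 0 := by
  obtain ⟨z, hz, rfl⟩ := hT.exists_erase hS hST
  rw [sideVec_erase hz]
  exact smul_ne_zero (neg_ne_zero.2 hT.vol_pos.ne') (hT.agrad_bary_ne_zero hd hz)

/-- The normal component of `a + b (x - x_T)` on a side is the flux. -/
lemma inner_sideVec {S : Finset (E d)} (hS : S.card = d) (hST : S ⊆ T) (a : E d) (b : ℝ) {x : E d}
    (hx : x ∈ convexHull ℝ (S : Set (E d))) :
    inner ℝ (a + b • (x - center T)) (sideVec T S) = flux T S a b := by
  obtain ⟨z, hz, rfl⟩ := hT.exists_erase hS hST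
  rw [flux, inner_add_left, sideVec_erase hz, real_inner_smul_left, real_inner_smul_right _ (agrad _),
    real_inner_smul_right, real_inner_comm (agrad (bary T z)) (x - center T), inner_agrad_sub,
    hT.bary_eq_zero_of_mem hz (T.erase_subset z) (by simp) hx, hT.bary_center hz]
  ring

/-- The outward unit normal is the normalized `sideVec`. -/
lemma outwardNormal_eq (hd : 1 ≤ d) {S : Finset (E d)} (hS : S.card = d) (hST : S ⊆ T) {n : E d}
    (hn : Triangulation.IsOutwardNormal T S n) : n = ‖sideVec T S‖⁻¹ • sideVec T S := by
  obtain ⟨z, hz, rfl⟩ := hT.exists_erase hS hST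
  obtain ⟨s, hs⟩ : (T.erase z).Nonempty := by rw [← Finset.card_pos]; omega
  obtain ⟨h1, h2, h3⟩ := hn
  have hneg := h3 s hs z (by simp [hz])
  set c : ℝ := inner ℝ n (z - s)
  have hna : ∀ x, (inner ℝ n (x - s) : ℝ) = c * bary T z x := by
    intro x
    let p : E d →ᵃ[ℝ] ℝ := (innerₗ (E d) n).toAffineMap.comp
      (AffineMap.id ℝ (E d) - AffineMap.const ℝ (E d) s)
    have hp : p = c • bary T z := by
      apply hT.affine_ext
      intro w hw
      by_cases hwz : w = z
      · subst hwz; simp [p, hT.bary_self hw, c]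
      · simpa [p, hT.bary_of_ne hz hw hwz] using h2 w (by simp [hw, hwz]) s hs
    have := congrArg (fun p : E d →ᵃ[ℝ] ℝ => p x) hp
    simpa [p] using this
  have hn' : n = c • agrad (bary T z) := by
    apply ext_inner_right ℝ
    intro v
    have e := hna (s + v)
    have e0 := hna s
    rw [add_sub_cancel_left] at e
    rw [sub_self, inner_zero_right] at e0
    rw [real_inner_smul_left, e, ← add_sub_cancel_left s v, inner_agrad_sub, add_sub_cancel_left,
      mul_sub, ← e0, sub_zero]
  have hv := hT.vol_pos
  rw [sideVec_erase hz, norm_smul, norm_neg, Real.norm_of_nonneg hv.le]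
  rw [hn', norm_smul, Real.norm_of_nonpos hneg.le] at h1
  have hg : ‖agrad (bary T z)‖ ≠ 0 := fun h => by rw [h] at h1; simp at h1
  rw [smul_smul, hn']
  congr 1
  field_simp
  linarith

lemma isOutwardNormal_sideVec (hd : 1 ≤ d) {S : Finset (E d)} (hS : S.card = d) (hST : S ⊆ T) :
    Triangulation.IsOutwardNormal T S (‖sideVec T S‖⁻¹ • sideVec T S) := by
  have hne := hT.sideVec_ne_zero hd hS hST
  have hpos : 0 < ‖sideVec T S‖⁻¹ := inv_pos.2 (norm_pos_iff.2 hne)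
  refine ⟨norm_smul_inv_norm hne, ?_, ?_⟩
  all_goals
    obtain ⟨z, hz, rfl⟩ := hT.exists_erase hS hST
    generalize ‖sideVec T (T.erase z)‖⁻¹ = κ at hpos
    rw [sideVec_erase hz]
    intro x hx y hy
    rw [real_inner_smul_left, real_inner_smul_left, inner_agrad_sub]
  · rw [hT.bary_of_ne hz (Finset.mem_of_mem_erase hx) (Finset.ne_of_mem_erase hx),
      hT.bary_of_ne hz (Finset.mem_of_mem_erase hy) (Finset.ne_of_mem_erase hy)]
    simp
  · obtain rfl : y = z := by
      rw [Finset.sdiff_erase_self hz] at hy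
      simpa using hy
    rw [hT.bary_of_ne hz (Finset.mem_of_mem_erase hx) (Finset.ne_of_mem_erase hx), hT.bary_self hz]
    have := mul_pos hpos hT.vol_pos
    linarith

/-- The integration by parts formula `local_parts` in terms of the fluxes. -/
lemma vol_mul_eq_sum_flux (hd : 1 ≤ d) (p : E d →ᵃ[ℝ] ℝ) (a : E d) (b : ℝ) :
    vol T * (inner ℝ a (agrad p) + d * b * p (center T))
      = d * ∑ S ∈ T.powersetCard d, p (Triangulation.barycenter S) * flux T S a b := by
  have hre : ∑ S ∈ T.powersetCard d, p (Triangulation.barycenter S) * flux T S a b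
      = ∑ z ∈ T, p (Triangulation.barycenter (T.erase z)) * flux T (T.erase z) a b := by
    symm
    refine Finset.sum_bij (fun z _ => T.erase z) ?_ ?_ ?_ ?_
    · exact fun z hz => Finset.mem_powersetCard.2 ⟨T.erase_subset z, hT.card_erase hz⟩
    · intro z hz w hw h
      exact (Finset.erase_inj T hz).1 h
    · intro S hS
      obtain ⟨h1, h2⟩ := Finset.mem_powersetCard.1 hS
      obtain ⟨z, hz, h⟩ := hT.exists_erase h2 h1
      exact ⟨z, hz, h.symm⟩
    · exact fun _ _ => rfl
  rw [hre, hT.local_parts hd, mul_neg, Finset.mul_sum, Finset.mul_sum, ← Finset.sum_neg_distrib]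
  refine Finset.sum_congr rfl fun z hz => ?_
  rw [flux, sideVec_erase hz, real_inner_smul_right]
  ring

end IsCell

/-! ### Neighbouring elements of a triangulation -/

namespace Triangulation

variable {Ω : Set (E d)} (𝒯 : Triangulation d Ω)

lemma mem_elements {T : Finset (E d)} : T ∈ 𝒯.elements ↔ T ∈ 𝒯.faces ∧ T.card = d + 1 := by
  simp [elements]

variable {𝒯}

lemma isCell {T : Finset (E d)} (hT : T ∈ 𝒯.elements) : IsCell T :=
  ⟨𝒯.indep (𝒯.mem_elements.1 hT).1, (𝒯.mem_elements.1 hT).2⟩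

lemma side_of_subset (hd : 1 ≤ d) {T S : Finset (E d)} (hT : T ∈ 𝒯.elements) (hST : S ⊆ T)
    (hS : S.card = d) : S ∈ 𝒯.sides :=
  ⟨𝒯.down_closed (𝒯.mem_elements.1 hT).1 hST (by rw [← Finset.card_pos]; omega), hS⟩

lemma inter_hull {T T' : Finset (E d)} (hT : T ∈ 𝒯.elements) (hT' : T' ∈ 𝒯.elements) :
    convexHull ℝ (T : Set (E d)) ∩ convexHull ℝ (T' : Set (E d))
      ⊆ convexHull ℝ ((T ∩ T' : Finset (E d)) : Set (E d)) := by
  rw [Finset.coe_inter]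
  exact 𝒯.inter_subset_convexHull (𝒯.mem_elements.1 hT).1 (𝒯.mem_elements.1 hT').1

lemma exists_notMem {T T' : Finset (E d)} (hT : T ∈ 𝒯.elements) (hT' : T' ∈ 𝒯.elements)
    (hne : T ≠ T') : ∃ z ∈ T, z ∉ T' := by
  by_contra! h
  exact hne (Finset.eq_of_subset_of_card_le h (by rw [(isCell hT).card, (isCell hT').card]))

lemma disjoint_interior {T T' : Finset (E d)} (hT : T ∈ 𝒯.elements) (hT' : T' ∈ 𝒯.elements)
    (hne : T ≠ T') : Disjoint (interior (convexHull ℝ (T : Set (E d))))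
      (interior (convexHull ℝ (T' : Set (E d)))) := by
  rw [Set.disjoint_left]
  intro x hx hx'
  obtain ⟨z, hz, hz'⟩ := exists_notMem hT hT' hne
  have h1 := inter_hull hT hT' ⟨interior_subset hx, interior_subset hx'⟩
  have h2 := (isCell hT).bary_eq_zero_of_mem hz Finset.inter_subset_left (by simp [hz']) h1
  exact ((isCell hT).mem_interior_iff.1 hx z hz).ne' h2

/-- Neighbouring elements lie on opposite sides of their common side: otherwise a point close to the
barycenter of the side would belong to both elements, but not to the side. -/
lemma bary_neg (hd : 1 ≤ d) {T T' : Finset (E d)} (hT : T ∈ 𝒯.elements) (hT' : T' ∈ 𝒯.elements)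
    {z z' : E d} (hz : z ∈ T) (hz' : z' ∈ T') (hzT : z' ∉ T)
    (hS : T.erase z = T'.erase z') : bary T z z' < 0 := by
  by_contra! h
  have cT := isCell hT
  have cT' := isCell hT'
  set S := T.erase z with hSdef
  have hScard : S.card = d := cT.card_erase hz
  set x := Triangulation.barycenter S with hx
  have hxS : x ∈ convexHull ℝ (S : Set (E d)) := barycenter_mem hd hScard
  have hST : S ⊆ T := T.erase_subset z
  have hST' : S ⊆ T' := hS ▸ T'.erase_subset z'
  have hpos : ∀ w ∈ S, 0 < bary T w x := by
    intro w hw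
    rw [hx, affine_barycenter hd _ hScard, Finset.sum_eq_single_of_mem w hw
      (fun v hv hne => cT.bary_of_ne (hST hw) (hST hv) hne), cT.bary_self (hST hw)]
    simp only [smul_eq_mul, mul_one]
    positivity
  have hev : ∀ᶠ t : ℝ in nhds 0, ∀ w ∈ S, 0 < bary T w (AffineMap.lineMap x z' t) := by
    rw [Finset.eventually_all]
    intro w hw
    have hcont : Continuous fun t : ℝ => bary T w (AffineMap.lineMap x z' t) := by
      simp only [AffineMap.apply_lineMap]
      exact AffineMap.lineMap_continuous
    exact hcont.continuousAt.eventually (lt_mem_nhds (by simpa using hpos w hw))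
  obtain ⟨t, ht, ht0, ht1⟩ : ∃ t : ℝ, (∀ w ∈ S, 0 < bary T w (AffineMap.lineMap x z' t)) ∧
      0 < t ∧ t < 1 := by
    have h1 := (hev.filter_mono (nhdsWithin_le_nhds (s := Ioi 0))).and
      (Ioo_mem_nhdsGT (one_pos : (0 : ℝ) < 1))
    obtain ⟨t, ht⟩ := h1.exists
    exact ⟨t, ht.1, ht.2.1, ht.2.2⟩
  set y := AffineMap.lineMap x z' t
  have hyT : y ∈ convexHull ℝ (T : Set (E d)) := by
    rw [cT.mem_hull_iff]
    intro w hw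
    by_cases hwz : w = z
    · subst hwz
      rw [AffineMap.apply_lineMap, cT.bary_eq_zero_of_mem hw hST (by simp [hSdef]) hxS,
        AffineMap.lineMap_apply]
      simp only [vsub_eq_sub, sub_zero, smul_eq_mul, vadd_eq_add, add_zero]
      positivity
    · exact (ht w (Finset.mem_erase.2 ⟨hwz, hw⟩)).le
  have hyT' : y ∈ convexHull ℝ (T' : Set (E d)) :=
    (convex_convexHull ℝ _).lineMap_mem (convexHull_mono (Finset.coe_subset.2 hST') hxS)
      (subset_convexHull ℝ _ hz') ⟨ht0.le, ht1.le⟩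
  have h1 := cT'.bary_eq_zero_of_mem hz' Finset.inter_subset_right (by simp [hzT])
    (inter_hull hT hT' ⟨hyT, hyT'⟩)
  rw [AffineMap.apply_lineMap, cT'.bary_eq_zero_of_mem hz' hST' (by simp [hS]) hxS,
    cT'.bary_self hz', AffineMap.lineMap_apply] at h1
  simp at h1
  exact ht0.ne' h1

/-- Barycentric coordinates of neighbouring elements, for the vertices opposite to the common side,
are proportional with a negative factor, which is also the ratio of the volumes. -/
lemma exists_bary_eq (hd : 1 ≤ d) {T T' S : Finset (E d)} (hT : T ∈ 𝒯.elements)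
    (hT' : T' ∈ 𝒯.elements) (hne : T ≠ T') (hS : S.card = d) (hST : S ⊆ T) (hST' : S ⊆ T') :
    ∃ z ∈ T, ∃ z' ∈ T', S = T.erase z ∧ S = T'.erase z' ∧ ∃ c < 0,
      bary T z = c • bary T' z' ∧ vol T' = -c * vol T := by
  have cT := isCell hT
  have cT' := isCell hT'
  obtain ⟨z, hz, h1⟩ := cT.exists_erase hS hST
  obtain ⟨z', hz', h2⟩ := cT'.exists_erase hS hST'
  have hzT : z' ∉ T := by
    intro h
    have hz'S : z' ∉ S := by simp [h2]
    have hzz : z' = z := by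
      by_contra hne'
      exact hz'S (by simp [h1, h, hne'])
    apply hne
    rw [← Finset.insert_erase hz, ← Finset.insert_erase hz', ← h1, ← h2, hzz]
  have hneg := bary_neg hd hT hT' hz hz' hzT (h1 ▸ h2)
  refine ⟨z, hz, z', hz', h1, h2, bary T z z', hneg, ?_, ?_⟩
  · apply cT'.affine_ext
    intro w hw
    by_cases hwz : w = z'
    · subst hwz; simp [cT'.bary_self hw]
    · have hwS : w ∈ S := by simp [h2, hw, hwz]
      have hwz' : w ≠ z := by rintro rfl; simp [h1] at hwS
      simp [cT'.bary_of_ne hz' hw hwz, cT.bary_of_ne hz (hST hwS) hwz']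
  · have h := cT.vol_of_common_side (S := S) (z := z) (z' := z')
      (by rw [h1, Finset.insert_erase hz]) (by simp [h1]) hneg.ne
    rw [h2, Finset.insert_erase hz', abs_of_neg hneg] at h
    exact h

lemma sideVec_neighbour (hd : 1 ≤ d) {T T' S : Finset (E d)} (hT : T ∈ 𝒯.elements)
    (hT' : T' ∈ 𝒯.elements) (hne : T ≠ T') (hS : S.card = d) (hST : S ⊆ T) (hST' : S ⊆ T') :
    sideVec T' S = -sideVec T S := by
  obtain ⟨z, hz, z', hz', h1, h2, c, -, hb, hv⟩ := exists_bary_eq hd hT hT' hne hS hST hST'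
  have e1 := sideVec_erase hz
  have e2 := sideVec_erase hz'
  rw [← h1] at e1
  rw [← h2] at e2
  rw [e1, e2, hv, hb, agrad_smul]
  module

/-- A side belongs to at most two elements. -/
lemma eq_or_eq_of_side_subset (hd : 1 ≤ d) {T T' T'' S : Finset (E d)} (hT : T ∈ 𝒯.elements)
    (hT' : T' ∈ 𝒯.elements) (hT'' : T'' ∈ 𝒯.elements) (hne : T ≠ T') (hS : S.card = d)
    (hST : S ⊆ T) (hST' : S ⊆ T') (hST'' : S ⊆ T'') : T'' = T ∨ T'' = T' := by
  by_contra! h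
  have e1 := sideVec_neighbour hd hT hT' hne hS hST hST'
  have e2 := sideVec_neighbour hd hT hT'' h.1.symm hS hST hST''
  have e3 := sideVec_neighbour hd hT' hT'' h.2.symm hS hST' hST''
  rw [e1, e2] at e3
  refine (isCell hT).sideVec_ne_zero hd hS hST ?_
  have : (2 : ℝ) • sideVec T S = 0 := by
    rw [two_smul]
    nth_rewrite 1 [← neg_neg (sideVec T S), ← e3]
    simp
  exact (smul_eq_zero.1 this).resolve_left (by norm_num)

lemma measure_face_eq_zero {S : Finset (E d)} (hS : S ∈ 𝒯.faces) (hc : S.card ≠ d + 1) :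
    volume (convexHull ℝ (S : Set (E d))) = 0 := by
  have hle : S.card ≤ d + 1 := by
    have := (𝒯.indep hS).card_le_finrank_succ
    have h2 := Submodule.finrank_le (vectorSpan ℝ (range ((↑) : S → E d)))
    simp at this h2
    omega
  refine measure_mono_null (convexHull_subset_affineSpan _)
    (Measure.addHaar_affineSubspace volume _ ?_)
  intro htop
  have := (𝒯.indep hS).affineSpan_eq_top_iff_card_eq_finrank_add_one
  simp at this
  exact hc (this.1 htop)

/-- The elements cover the closure of the domain, since the other simplices are null sets. -/
lemma closure_subset (hΩ : IsOpen Ω) :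
    closure Ω ⊆ ⋃ T ∈ 𝒯.elements, convexHull ℝ (T : Set (E d)) := by
  have hclosed : IsClosed (⋃ T ∈ 𝒯.elements, convexHull ℝ (T : Set (E d))) :=
    isClosed_biUnion_finset fun T _ => (isCompact_hull T).isClosed
  apply closure_minimal _ hclosed
  have hopen : IsOpen (Ω \ ⋃ T ∈ 𝒯.elements, convexHull ℝ (T : Set (E d))) := hΩ.sdiff hclosed
  have hnull : volume (Ω \ ⋃ T ∈ 𝒯.elements, convexHull ℝ (T : Set (E d))) = 0 := by
    have hsub : Ω \ (⋃ T ∈ 𝒯.elements, convexHull ℝ (T : Set (E d)))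
        ⊆ ⋃ S ∈ {S | S ∈ 𝒯.faces ∧ S.card ≠ d + 1}, convexHull ℝ (S : Set (E d)) := by
      rintro x ⟨hx, hxT⟩
      have h1 : x ∈ 𝒯.toSimplicialComplex.space := 𝒯.space_eq ▸ subset_closure hx
      obtain ⟨S, hS, hxS⟩ := Geometry.SimplicialComplex.mem_space_iff.1 h1
      refine mem_biUnion (x := S) ⟨hS, fun hc => hxT ?_⟩ hxS
      exact mem_biUnion (x := S) (𝒯.mem_elements.2 ⟨hS, hc⟩) hxS
    refine measure_mono_null hsub ?_
    rw [measure_biUnion_null_iff (𝒯.finite_faces.subset fun S hS => hS.1).countable]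
    exact fun S hS => measure_face_eq_zero hS.1 hS.2
  have := (hopen.measure_eq_zero_iff volume).1 hnull
  exact sdiff_eq_empty.1 this

/-- Boundary sides lie in the boundary of the domain: an interior point of `Ω` in the relative
interior of the side is a limit of points of `Ω` on the other side of the hyperplane through `S`, so
that it belongs to another element, which contains `S` by conformity. -/
lemma boundarySide_subset_frontier (hd : 1 ≤ d) (hΩ : IsOpen Ω) {S : Finset (E d)}
    (hS : S ∈ 𝒯.boundarySides) : convexHull ℝ (S : Set (E d)) ⊆ frontier Ω := by
  obtain ⟨⟨hSf, hScard⟩, T, ⟨hT, hST⟩, huniq⟩ := hS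
  intro x hx
  rw [hΩ.frontier_eq]
  refine ⟨𝒯.space_eq ▸ Geometry.SimplicialComplex.convexHull_subset_space hSf hx, fun hxΩ => ?_⟩
  have cT := isCell hT
  obtain ⟨z, hz, hSz⟩ := cT.exists_erase hScard hST
  obtain ⟨y, hyΩ, hyS, hypos⟩ : ∃ y ∈ Ω, y ∈ convexHull ℝ (S : Set (E d)) ∧
      ∀ w ∈ S, 0 < bary T w y := by
    have hev : ∀ᶠ t : ℝ in nhds 0, AffineMap.lineMap x (barycenter S) t ∈ Ω :=
      (AffineMap.lineMap_continuous (p := x) (q := barycenter S) (R := ℝ)).continuousAt.eventually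
        (hΩ.mem_nhds (by simpa using hxΩ))
    obtain ⟨t, ht, ht0, ht1⟩ := ((hev.filter_mono (nhdsWithin_le_nhds (s := Ioi 0))).and
      (Ioo_mem_nhdsGT (one_pos : (0 : ℝ) < 1))).exists
    have hb := barycenter_mem hd hScard
    refine ⟨_, ht, (convex_convexHull ℝ _).lineMap_mem hx hb ⟨ht0.le, ht1.le⟩, fun w hw => ?_⟩
    have h1 := cT.mem_hull_iff.1 (convexHull_mono (Finset.coe_subset.2 hST) hx) w (hST hw)
    have h2 : 0 < bary T w (barycenter S) := by
      rw [affine_barycenter hd _ hScard, Finset.sum_eq_single_of_mem w hw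
        (fun v hv hne => cT.bary_of_ne (hST hw) (hST hv) hne), cT.bary_self (hST hw)]
      simp only [smul_eq_mul, mul_one]
      positivity
    rw [AffineMap.apply_lineMap, AffineMap.lineMap_apply_module]
    simp only [smul_eq_mul]
    have := mul_nonneg (sub_nonneg.2 ht1.le) h1
    have := mul_pos ht0 h2
    linarith
  have hyT := convexHull_mono (Finset.coe_subset.2 hST) hyS
  have hother : ∀ T' ∈ 𝒯.elements.erase T, y ∉ convexHull ℝ (T' : Set (E d)) := by
    intro T' hT' hy
    obtain ⟨hne, hT'⟩ := Finset.mem_erase.1 hT'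
    refine hne (huniq T' ⟨hT', fun w hw => ?_⟩)
    by_contra hwT'
    exact (hypos w hw).ne' (cT.bary_eq_zero_of_mem (hST hw) Finset.inter_subset_left
      (by simp [hwT']) (inter_hull hT hT' ⟨hyT, hy⟩))
  have hcont : ContinuousAt (fun s : ℝ => AffineMap.lineMap y z s) 0 :=
    AffineMap.lineMap_continuous.continuousAt
  have hev1 : ∀ᶠ s : ℝ in nhds 0, AffineMap.lineMap y z s ∈ Ω :=
    hcont.eventually (hΩ.mem_nhds (by simpa using hyΩ))
  have hev2 : ∀ᶠ s : ℝ in nhds 0, ∀ T' ∈ 𝒯.elements.erase T,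
      AffineMap.lineMap y z s ∉ convexHull ℝ (T' : Set (E d)) := by
    rw [Finset.eventually_all]
    intro T' hT'
    exact hcont.eventually ((isCompact_hull T').isClosed.isOpen_compl.mem_nhds
      (by simpa using hother T' hT'))
  obtain ⟨s, ⟨hs1, hs2⟩, hs⟩ := (((hev1.and hev2).filter_mono
    (nhdsWithin_le_nhds (s := Iio 0))).and self_mem_nhdsWithin).exists
  obtain ⟨T', hT', hsT'⟩ := mem_iUnion₂.1 (closure_subset hΩ (subset_closure hs1))
  by_cases hTT' : T' = T
  · subst hTT'
    have h1 := cT.mem_hull_iff.1 hsT' z hz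
    rw [AffineMap.apply_lineMap, cT.bary_eq_zero_of_mem hz hST (by simp [hSz]) hyS,
      cT.bary_self hz, AffineMap.lineMap_apply_module] at h1
    simp at h1
    exact not_lt.2 h1 hs
  · exact hs2 T' (Finset.mem_erase.2 ⟨hTT', hT'⟩) hsT'

end Triangulation

/-! ### Integrals of element-wise constant functions -/

namespace Triangulation

variable {Ω : Set (E d)} {𝒯 : Triangulation d Ω}

lemma interior_subset_domain (hΩ : interior (closure Ω) = Ω) {T : Finset (E d)}
    (hT : T ∈ 𝒯.elements) : interior (convexHull ℝ (T : Set (E d))) ⊆ Ω := by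
  rw [← hΩ, ← 𝒯.space_eq]
  exact interior_mono
    (Geometry.SimplicialComplex.convexHull_subset_space (𝒯.mem_elements.1 hT).1)

lemma domain_ae_eq (hΩ : interior (closure Ω) = Ω) :
    (Ω : Set (E d)) =ᵐ[volume] ⋃ T ∈ 𝒯.elements, interior (convexHull ℝ (T : Set (E d))) := by
  have hopen : IsOpen Ω := hΩ ▸ isOpen_interior
  rw [ae_eq_set]
  constructor
  · refine measure_mono_null (t := ⋃ T ∈ 𝒯.elements, frontier (convexHull ℝ (T : Set (E d)))) ?_ ?_
    · rintro x ⟨hx, hx'⟩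
      obtain ⟨T, hT, hxT⟩ := mem_iUnion₂.1 (closure_subset hopen (subset_closure hx))
      refine mem_biUnion (x := T) hT ⟨subset_closure hxT, fun h => hx' ?_⟩
      exact mem_biUnion (x := T) hT h
    · exact (measure_biUnion_null_iff 𝒯.elements.countable_toSet).2
        fun T _ => (convex_convexHull ℝ _).addHaar_frontier volume
  · have hsub : (⋃ T ∈ 𝒯.elements, interior (convexHull ℝ (T : Set (E d)))) ⊆ Ω :=
      iUnion₂_subset fun T hT => interior_subset_domain hΩ hT
    rw [sdiff_eq_empty.2 hsub, measure_empty]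

lemma ae_domain_iff (hΩ : interior (closure Ω) = Ω) {P : E d → Prop} :
    (∀ᵐ x ∂(volume.restrict Ω), P x) ↔ ∀ T ∈ 𝒯.elements,
      ∀ᵐ x ∂(volume.restrict (interior (convexHull ℝ (T : Set (E d))))), P x := by
  rw [Measure.restrict_congr_set (domain_ae_eq hΩ), ae_restrict_biUnion_finset_iff]

lemma lintegral_domain (hΩ : interior (closure Ω) = Ω) {f : E d → ENNReal}
    {a : Finset (E d) → ENNReal} (h : ∀ T ∈ 𝒯.elements,
      ∀ᵐ x ∂(volume.restrict (interior (convexHull ℝ (T : Set (E d))))), f x = a T) :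
    ∫⁻ x in Ω, f x = ∑ T ∈ 𝒯.elements, a T * ENNReal.ofReal (vol T) := by
  rw [Measure.restrict_congr_set (domain_ae_eq hΩ), lintegral_biUnion_finset
    (fun T hT T' hT' hne => disjoint_interior hT hT' hne) (fun T _ => isOpen_interior.measurableSet)]
  refine Finset.sum_congr rfl fun T hT => ?_
  rw [lintegral_congr_ae (h T hT), setLIntegral_const, measure_interior]

/-- The integral of an element-wise constant function that does not take the value `-∞`: it is a
finite sum, or `+∞` as soon as the function is `+∞` on some element. -/
lemma eintegral_cases (hΩ : interior (closure Ω) = Ω) {f : E d → EReal}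
    {a : Finset (E d) → EReal} (h : ∀ T ∈ 𝒯.elements,
      ∀ᵐ x ∂(volume.restrict (interior (convexHull ℝ (T : Set (E d))))), f x = a T)
    (hbot : ∀ T ∈ 𝒯.elements, a T ≠ ⊥) :
    ((∀ T ∈ 𝒯.elements, a T ≠ ⊤) ∧
      eintegral Ω f = ((∑ T ∈ 𝒯.elements, vol T * (a T).toReal : ℝ) : EReal)) ∨
    ((∃ T ∈ 𝒯.elements, a T = ⊤) ∧ eintegral Ω f = ⊤) := by
  have h1 : ∫⁻ x in Ω, (f x).toENNReal
      = ∑ T ∈ 𝒯.elements, (a T).toENNReal * ENNReal.ofReal (vol T) :=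
    lintegral_domain hΩ fun T hT => (h T hT).mono fun x hx => by rw [hx]
  have h2 : ∫⁻ x in Ω, (-f x).toENNReal
      = ∑ T ∈ 𝒯.elements, (-a T).toENNReal * ENNReal.ofReal (vol T) :=
    lintegral_domain hΩ fun T hT => (h T hT).mono fun x hx => by rw [hx]
  have hneg : ∑ T ∈ 𝒯.elements, (-a T).toENNReal * ENNReal.ofReal (vol T) ≠ ⊤ := by
    rw [ENNReal.sum_ne_top]
    refine fun T hT => ENNReal.mul_ne_top ?_ ENNReal.ofReal_ne_top
    rw [Ne, EReal.toENNReal_eq_top_iff, EReal.neg_eq_top_iff]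
    exact hbot T hT
  unfold eintegral
  rw [h1, h2]
  by_cases htop : ∃ T ∈ 𝒯.elements, a T = ⊤
  · right
    obtain ⟨T, hT, haT⟩ := htop
    refine ⟨⟨T, hT, haT⟩, ?_⟩
    have : ∑ T ∈ 𝒯.elements, (a T).toENNReal * ENNReal.ofReal (vol T) = ⊤ := by
      rw [ENNReal.sum_eq_top]
      refine ⟨T, hT, ?_⟩
      rw [haT, EReal.toENNReal_top, ENNReal.top_mul]
      exact (ENNReal.ofReal_pos.2 (isCell hT).vol_pos).ne'
    rw [this, EReal.coe_ennreal_top, EReal.top_sub]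
    simpa using hneg
  · left
    push Not at htop
    refine ⟨htop, ?_⟩
    have hvol : ∀ T ∈ 𝒯.elements, 0 ≤ vol T := fun T hT => (isCell hT).vol_pos.le
    have hmax : ∀ r : ℝ, ENNReal.ofReal (max r 0) = ENNReal.ofReal r := fun r => by
      rcases le_total 0 r with h | h <;> simp [h, ENNReal.ofReal_of_nonpos]
    have e1 : ∀ T ∈ 𝒯.elements, (a T).toENNReal * ENNReal.ofReal (vol T)
        = ENNReal.ofReal (max (a T).toReal 0 * vol T) := fun T hT => by
      rw [ENNReal.ofReal_mul (le_max_right _ _), EReal.toENNReal_of_ne_top (htop T hT), hmax]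
    have e2 : ∀ T ∈ 𝒯.elements, (-a T).toENNReal * ENNReal.ofReal (vol T)
        = ENNReal.ofReal (max (-(a T).toReal) 0 * vol T) := fun T hT => by
      rw [ENNReal.ofReal_mul (le_max_right _ _), EReal.toENNReal_of_ne_top
        (by rw [Ne, EReal.neg_eq_top_iff]; exact hbot T hT), hmax]
      simp
    have n1 : ∀ T ∈ 𝒯.elements, 0 ≤ max (a T).toReal 0 * vol T :=
      fun T hT => mul_nonneg (le_max_right _ _) (hvol T hT)
    have n2 : ∀ T ∈ 𝒯.elements, 0 ≤ max (-(a T).toReal) 0 * vol T :=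
      fun T hT => mul_nonneg (le_max_right _ _) (hvol T hT)
    rw [Finset.sum_congr rfl e1, Finset.sum_congr rfl e2, ← ENNReal.ofReal_sum_of_nonneg n1,
      ← ENNReal.ofReal_sum_of_nonneg n2, EReal.coe_ennreal_ofReal, EReal.coe_ennreal_ofReal,
      max_eq_left (Finset.sum_nonneg n1), max_eq_left (Finset.sum_nonneg n2), ← EReal.coe_sub,
      ← Finset.sum_sub_distrib]
    congr 1
    refine Finset.sum_congr rfl fun T _ => ?_
    rw [← sub_mul, mul_comm]
    congr 1
    rcases le_total 0 (a T).toReal with h0 | h0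
    · rw [max_eq_left h0, max_eq_right (neg_nonpos.2 h0), sub_zero]
    · rw [max_eq_right h0, max_eq_left (neg_nonneg.2 h0)]
      ring

/-! ### Element-wise affine functions -/

/-- The function that equals the affine function `p T` in the interior of each element `T`. -/
noncomputable def piecewise {F : Type*} [NormedAddCommGroup F] [NormedSpace ℝ F]
    (𝒯 : Triangulation d Ω) (p : Finset (E d) → (E d →ᵃ[ℝ] F)) (x : E d) : F :=
  ∑ T ∈ 𝒯.elements, (interior (convexHull ℝ (T : Set (E d)))).indicator (p T) x

lemma sum_indicator {F : Type*} [AddCommMonoid F] (f : Finset (E d) → E d → F)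
    {T : Finset (E d)} (hT : T ∈ 𝒯.elements) {x : E d}
    (hx : x ∈ interior (convexHull ℝ (T : Set (E d)))) :
    ∑ T ∈ 𝒯.elements, (interior (convexHull ℝ (T : Set (E d)))).indicator (f T) x = f T x := by
  rw [Finset.sum_eq_single_of_mem T hT, indicator_of_mem hx]
  intro T' hT' hne
  exact indicator_of_notMem (Set.disjoint_left.1 (disjoint_interior hT hT' hne.symm) hx) _

section

variable {F : Type*} [NormedAddCommGroup F] [NormedSpace ℝ F]

lemma isPiecewise_piecewise (p : Finset (E d) → (E d →ᵃ[ℝ] F)) :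
    𝒯.IsPiecewise (𝒯.piecewise p) p :=
  fun _ hT _ hx => sum_indicator (fun T => p T) hT hx

lemma proj_eq [CompleteSpace F] {v : E d → F} {p : Finset (E d) → (E d →ᵃ[ℝ] F)}
    (hv : 𝒯.IsPiecewise v p) {T : Finset (E d)} (hT : T ∈ 𝒯.elements) {x : E d}
    (hx : x ∈ interior (convexHull ℝ (T : Set (E d)))) : 𝒯.proj v x = p T (center T) := by
  rw [proj, sum_indicator _ hT hx, ← (isCell hT).average_affine (p T)]
  have h1 : ∀ f : E d → F, ⨍ y in convexHull ℝ (T : Set (E d)), f y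
      = ⨍ y in interior (convexHull ℝ (T : Set (E d))), f y := fun f => by
    rw [Measure.restrict_congr_set (ae_eq_interior T)]
  rw [h1, h1]
  refine average_congr ?_
  exact (ae_restrict_iff' isOpen_interior.measurableSet).2 (.of_forall fun y hy => hv T hT hy)

end

lemma proj_id {T : Finset (E d)} (hT : T ∈ 𝒯.elements) {x : E d}
    (hx : x ∈ interior (convexHull ℝ (T : Set (E d)))) : 𝒯.proj id x = center T :=
  proj_eq (p := fun _ => AffineMap.id ℝ (E d)) (fun _ _ _ _ => rfl) hT hx

lemma gradh_eq {v : E d → ℝ} {p : Finset (E d) → (E d →ᵃ[ℝ] ℝ)}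
    (hv : 𝒯.IsPiecewise v p) {T : Finset (E d)} (hT : T ∈ 𝒯.elements) {x : E d}
    (hx : x ∈ interior (convexHull ℝ (T : Set (E d)))) : gradh v x = agrad (p T) :=
  ((hasGradientAt_affine (p T) x).congr_of_eventuallyEq
    (Filter.eventually_of_mem (isOpen_interior.mem_nhds hx) (hv T hT))).gradient

end Triangulation

/-- The affine vector field `x ↦ a + b (x - x_T)`. -/
noncomputable def rtMap (T : Finset (E d)) (a : E d) (b : ℝ) : E d →ᵃ[ℝ] E d :=
  AffineMap.const ℝ (E d) a + b • (AffineMap.id ℝ (E d) - AffineMap.const ℝ (E d) (center T))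

lemma rtMap_apply (T : Finset (E d)) (a : E d) (b : ℝ) (x : E d) :
    rtMap T a b x = a + b • (x - center T) := by
  simp [rtMap]

lemma rtMap_center (T : Finset (E d)) (a : E d) (b : ℝ) : rtMap T a b (center T) = a := by
  simp [rtMap]

lemma Triangulation.divh_eq {Ω : Set (E d)} {𝒯 : Triangulation d Ω} {y : E d → E d}
    {a : Finset (E d) → E d} {b : Finset (E d) → ℝ}
    (hy : 𝒯.IsPiecewise y (fun T => rtMap T (a T) (b T))) {T : Finset (E d)}
    (hT : T ∈ 𝒯.elements) {x : E d} (hx : x ∈ interior (convexHull ℝ (T : Set (E d)))) :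
    divh y x = d * b T := by
  have h1 : fderiv ℝ y x = LinearMap.toContinuousLinearMap (rtMap T (a T) (b T)).linear :=
    ((hasFDerivAt_affine (rtMap T (a T) (b T)) x).congr_of_eventuallyEq
      (Filter.eventually_of_mem (isOpen_interior.mem_nhds hx) (hy T hT))).fderiv
  rw [divh, h1]
  simp [rtMap]

/-- The affine function `x ↦ s + ⟨q, x - x_T⟩`. -/
noncomputable def crMap (T : Finset (E d)) (q : E d) (s : ℝ) : E d →ᵃ[ℝ] ℝ :=
  AffineMap.const ℝ (E d) s + (innerₗ (E d) q).toAffineMap.comp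
    (AffineMap.id ℝ (E d) - AffineMap.const ℝ (E d) (center T))

lemma crMap_apply (T : Finset (E d)) (q : E d) (s : ℝ) (x : E d) :
    crMap T q s x = s + inner ℝ q (x - center T) := by
  simp [crMap, inner_sub_right]

lemma crMap_center (T : Finset (E d)) (q : E d) (s : ℝ) : crMap T q s (center T) = s := by
  simp [crMap]

lemma agrad_crMap (T : Finset (E d)) (q : E d) (s : ℝ) : agrad (crMap T q s) = q := by
  apply ext_inner_right ℝ
  intro v
  rw [← sub_zero v, inner_agrad_sub, crMap_apply, crMap_apply, add_sub_add_left_eq_sub,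
    ← inner_sub_right]
  simp

/-! ### The functionals in terms of the elements -/

namespace Triangulation

variable {Ω : Set (E d)} {𝒯 : Triangulation d Ω} {φ : E d → EReal} {ψ : E d → ℝ → EReal}
  {g : Finset (E d) → ℝ → EReal}

lemma primal_cases (hΩ : interior (closure Ω) = Ω) (hφ : ProperConvexLSC φ)
    (hg : ∀ T ∈ 𝒯.elements, ProperConvexLSC (g T))
    (hψg : ∀ T ∈ 𝒯.elements,
      ∀ᵐ x ∂(volume.restrict (interior (convexHull ℝ (T : Set (E d))))), ψ x = g T)
    {v : E d → ℝ} {p : Finset (E d) → (E d →ᵃ[ℝ] ℝ)} (hv : 𝒯.IsPiecewise v p) :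
    ((∀ T ∈ 𝒯.elements, φ (agrad (p T)) ≠ ⊤ ∧ g T (p T (center T)) ≠ ⊤) ∧
      primal 𝒯 φ ψ v = ((∑ T ∈ 𝒯.elements, vol T *
        ((φ (agrad (p T))).toReal + (g T (p T (center T))).toReal) : ℝ) : EReal)) ∨
    ((∃ T ∈ 𝒯.elements, φ (agrad (p T)) = ⊤ ∨ g T (p T (center T)) = ⊤) ∧
      primal 𝒯 φ ψ v = ⊤) := by
  have c1 := eintegral_cases (𝒯 := 𝒯) hΩ (f := fun x => φ (gradh v x))
    (a := fun T => φ (agrad (p T)))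
    (fun T hT => (ae_restrict_iff' isOpen_interior.measurableSet).2 (.of_forall fun x hx => by
      rw [gradh_eq hv hT hx])) (fun T _ => hφ.ne_bot _)
  have c2 := eintegral_cases (𝒯 := 𝒯) hΩ (f := fun x => ψ x (𝒯.proj v x))
    (a := fun T => g T (p T (center T)))
    (fun T hT => by
      filter_upwards [hψg T hT, ae_restrict_mem isOpen_interior.measurableSet] with x hx hxT
      rw [hx, proj_eq hv hT hxT]) (fun T hT => (hg T hT).ne_bot _)
  unfold primal
  rcases c1 with ⟨f1, e1⟩ | ⟨⟨T, hT, h1⟩, e1⟩ <;> rcases c2 with ⟨f2, e2⟩ | ⟨⟨T', hT', h2⟩, e2⟩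
  · refine .inl ⟨fun T hT => ⟨f1 T hT, f2 T hT⟩, ?_⟩
    rw [e1, e2, ← EReal.coe_add, ← Finset.sum_add_distrib]
    simp_rw [mul_add]
  · exact .inr ⟨⟨T', hT', .inr h2⟩, by rw [e1, e2, EReal.coe_add_top]⟩
  · exact .inr ⟨⟨T, hT, .inl h1⟩, by rw [e1, e2, EReal.top_add_coe]⟩
  · exact .inr ⟨⟨T, hT, .inl h1⟩, by rw [e1, e2, EReal.top_add_top]⟩

lemma dual_cases (hΩ : interior (closure Ω) = Ω) (hφ : ProperConvexLSC φ)
    (hg : ∀ T ∈ 𝒯.elements, ProperConvexLSC (g T))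
    (hψg : ∀ T ∈ 𝒯.elements,
      ∀ᵐ x ∂(volume.restrict (interior (convexHull ℝ (T : Set (E d))))), ψ x = g T)
    {y : E d → E d} {a : Finset (E d) → E d} {b : Finset (E d) → ℝ}
    (hy : 𝒯.IsPiecewise y (fun T => rtMap T (a T) (b T))) :
    ((∀ T ∈ 𝒯.elements, conj φ (a T) ≠ ⊤ ∧ conj (g T) (d * b T) ≠ ⊤) ∧
      dual 𝒯 φ ψ y = ((-∑ T ∈ 𝒯.elements, vol T *
        ((conj φ (a T)).toReal + (conj (g T) (d * b T)).toReal) : ℝ) : EReal)) ∨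
    ((∃ T ∈ 𝒯.elements, conj φ (a T) = ⊤ ∨ conj (g T) (d * b T) = ⊤) ∧
      dual 𝒯 φ ψ y = ⊥) := by
  have c1 := eintegral_cases (𝒯 := 𝒯) hΩ (f := fun x => conj φ (𝒯.proj y x))
    (a := fun T => conj φ (a T))
    (fun T hT => (ae_restrict_iff' isOpen_interior.measurableSet).2 (.of_forall fun x hx => by
      rw [proj_eq hy hT hx, rtMap_center])) (fun T _ => conj_ne_bot hφ _)
  have c2 := eintegral_cases (𝒯 := 𝒯) hΩ (f := fun x => conj (ψ x) (divh y x))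
    (a := fun T => conj (g T) (d * b T))
    (fun T hT => by
      filter_upwards [hψg T hT, ae_restrict_mem isOpen_interior.measurableSet] with x hx hxT
      rw [hx, divh_eq hy hT hxT]) (fun T hT => conj_ne_bot (hg T hT) _)
  unfold dual
  rcases c1 with ⟨f1, e1⟩ | ⟨⟨T, hT, h1⟩, e1⟩ <;> rcases c2 with ⟨f2, e2⟩ | ⟨⟨T', hT', h2⟩, e2⟩
  · refine .inl ⟨fun T hT => ⟨f1 T hT, f2 T hT⟩, ?_⟩
    rw [e1, e2, ← EReal.coe_neg, ← EReal.coe_sub]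
    simp_rw [mul_add]
    rw [Finset.sum_add_distrib, neg_add, sub_eq_add_neg]
  · exact .inr ⟨⟨T', hT', .inr h2⟩, by rw [e2, EReal.sub_top]⟩
  · exact .inr ⟨⟨T, hT, .inl h1⟩, by rw [e1, EReal.neg_top, EReal.bot_sub]⟩
  · exact .inr ⟨⟨T, hT, .inl h1⟩, by rw [e1, EReal.neg_top, EReal.bot_sub]⟩

end Triangulation

/-! ### The discrete spaces in terms of fluxes and values at barycenters of sides -/

namespace Triangulation

variable {Ω : Set (E d)} {𝒯 : Triangulation d Ω}

/-- The continuity and boundary conditions of the Crouzeix--Raviart space for the family of affine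
functions `p`. -/
def IsCR (𝒯 : Triangulation d Ω) (ΓD : Set (E d)) (p : Finset (E d) → (E d →ᵃ[ℝ] ℝ)) : Prop :=
  (∀ S ∈ 𝒯.sides, ∀ T ∈ 𝒯.elements, ∀ T' ∈ 𝒯.elements, S ⊆ T → S ⊆ T' →
      p T (barycenter S) = p T' (barycenter S)) ∧
    (∀ S ∈ 𝒯.boundarySides, convexHull ℝ (S : Set (E d)) ⊆ ΓD →
      ∀ T ∈ 𝒯.elements, S ⊆ T → p T (barycenter S) = 0)

/-- The continuity and boundary conditions of the Raviart--Thomas space for the vector fields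
`a T + b T (x - x_T)`, in terms of their fluxes. -/
def IsRT (𝒯 : Triangulation d Ω) (ΓN : Set (E d)) (a : Finset (E d) → E d)
    (b : Finset (E d) → ℝ) : Prop :=
  (∀ S ∈ 𝒯.sides, ∀ T ∈ 𝒯.elements, ∀ T' ∈ 𝒯.elements, T ≠ T' → S ⊆ T → S ⊆ T' →
      flux T S (a T) (b T) + flux T' S (a T') (b T') = 0) ∧
    (∀ S ∈ 𝒯.boundarySides, (convexHull ℝ (S : Set (E d)) ∩ ΓN).Nonempty →
      ∀ T ∈ 𝒯.elements, S ⊆ T → flux T S (a T) (b T) = 0)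

lemma mem_crSpace_iff {ΓD : Set (E d)} {v : E d → ℝ} :
    v ∈ 𝒯.crSpace ΓD ↔ ∃ p, 𝒯.IsPiecewise v p ∧ 𝒯.IsCR ΓD p := Iff.rfl

lemma inner_rtMap_normal (hd : 1 ≤ d) {T S : Finset (E d)} (hT : T ∈ 𝒯.elements)
    (hS : S.card = d) (hST : S ⊆ T) (a : E d) (b : ℝ) {n x : E d} (hn : IsOutwardNormal T S n)
    (hx : x ∈ convexHull ℝ (S : Set (E d))) :
    inner ℝ (rtMap T a b x) n = ‖sideVec T S‖⁻¹ * flux T S a b := by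
  rw [(isCell hT).outwardNormal_eq hd hS hST hn, real_inner_smul_right, rtMap_apply,
    (isCell hT).inner_sideVec hS hST a b hx]

lemma isRT_of_normal (hd : 1 ≤ d) {ΓN : Set (E d)} {a : Finset (E d) → E d}
    {b : Finset (E d) → ℝ}
    (h1 : ∀ S ∈ 𝒯.sides, ∀ T ∈ 𝒯.elements, ∀ T' ∈ 𝒯.elements, T ≠ T' → S ⊆ T → S ⊆ T' →
      ∀ n n', IsOutwardNormal T S n → IsOutwardNormal T' S n' →
      ∀ x ∈ convexHull ℝ (S : Set (E d)),
        inner ℝ (rtMap T (a T) (b T) x) n + inner ℝ (rtMap T' (a T') (b T') x) n' = 0)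
    (h2 : ∀ S ∈ 𝒯.boundarySides, ∀ T ∈ 𝒯.elements, S ⊆ T → ∀ n, IsOutwardNormal T S n →
      ∀ x ∈ convexHull ℝ (S : Set (E d)) ∩ ΓN, inner ℝ (rtMap T (a T) (b T) x) n = 0) :
    𝒯.IsRT ΓN a b := by
  constructor
  · intro S hS T hT T' hT' hne hST hST'
    have n1 := (isCell hT).isOutwardNormal_sideVec hd hS.2 hST
    have n2 := (isCell hT').isOutwardNormal_sideVec hd hS.2 hST'
    have hx := barycenter_mem hd hS.2
    have h := h1 S hS T hT T' hT' hne hST hST' _ _ n1 n2 _ hx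
    rw [inner_rtMap_normal hd hT hS.2 hST _ _ n1 hx, inner_rtMap_normal hd hT' hS.2 hST' _ _ n2 hx,
      sideVec_neighbour hd hT hT' hne hS.2 hST hST', norm_neg, ← mul_add] at h
    exact (mul_eq_zero.1 h).resolve_left
      (inv_ne_zero (norm_ne_zero_iff.2 ((isCell hT).sideVec_ne_zero hd hS.2 hST)))
  · rintro S hS ⟨x, hx⟩ T hT hST
    have n1 := (isCell hT).isOutwardNormal_sideVec hd hS.1.2 hST
    have h := h2 S hS T hT hST _ n1 x hx
    rw [inner_rtMap_normal hd hT hS.1.2 hST _ _ n1 hx.1] at h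
    exact (mul_eq_zero.1 h).resolve_left
      (inv_ne_zero (norm_ne_zero_iff.2 ((isCell hT).sideVec_ne_zero hd hS.1.2 hST)))

lemma mem_rtSpace_iff (hd : 1 ≤ d) {ΓN : Set (E d)} {y : E d → E d} :
    y ∈ 𝒯.rtSpace ΓN ↔ ∃ a b, 𝒯.IsPiecewise y (fun T => rtMap T (a T) (b T)) ∧
      𝒯.IsRT ΓN a b := by
  constructor
  · rintro ⟨q, hq, h1, h2, h3⟩
    have hform : ∀ T, ∃ b : ℝ, T ∈ 𝒯.elements → q T = rtMap T (q T (center T)) b := by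
      intro T
      by_cases hT : T ∈ 𝒯.elements
      · have cT := isCell hT
        obtain ⟨b, hb⟩ := cT.rt_form hd (q T) (by
          intro z hz x hx y hy
          have hS := cT.card_erase hz
          have n1 := cT.isOutwardNormal_sideVec hd hS (T.erase_subset z)
          obtain ⟨c, hc⟩ := h1 _ (side_of_subset hd hT (T.erase_subset z) hS) T hT
            (T.erase_subset z) _ n1
          have e := (hc x (subset_convexHull ℝ _ hx)).trans (hc y (subset_convexHull ℝ _ hy)).symm
          rw [← sub_eq_zero, ← inner_sub_left, real_inner_smul_right] at e
          have e' := (mul_eq_zero.1 e).resolve_left (inv_ne_zero (norm_ne_zero_iff.2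
            (cT.sideVec_ne_zero hd hS (T.erase_subset z))))
          rw [sideVec_erase hz, real_inner_smul_right] at e'
          exact (mul_eq_zero.1 e').resolve_left (neg_ne_zero.2 cT.vol_pos.ne'))
        refine ⟨b, fun _ => ?_⟩
        ext1 x
        rw [hb x, rtMap_apply]
      · exact ⟨0, fun h => absurd h hT⟩
    choose b hb using hform
    refine ⟨fun T => q T (center T), b, fun T hT x hx => ?_, isRT_of_normal hd ?_ ?_⟩
    · simp only [← hb T hT]
      exact hq T hT hx
    · intro S hS T hT T' hT'
      rw [← hb T hT, ← hb T' hT']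
      exact h2 S hS T hT T' hT'
    · intro S hS T hT
      rw [← hb T hT]
      exact h3 S hS T hT
  · rintro ⟨a, b, hy, h1, h2⟩
    refine ⟨_, hy, ?_, ?_, ?_⟩
    · intro S hS T hT hST n hn
      exact ⟨_, fun x hx => inner_rtMap_normal hd hT hS.2 hST _ _ hn hx⟩
    · intro S hS T hT T' hT' hne hST hST' n n' hn hn' x hx
      rw [inner_rtMap_normal hd hT hS.2 hST _ _ hn hx,
        inner_rtMap_normal hd hT' hS.2 hST' _ _ hn' hx,
        sideVec_neighbour hd hT hT' hne hS.2 hST hST', norm_neg, ← mul_add,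
        h1 S hS T hT T' hT' hne hST hST', mul_zero]
    · intro S hS T hT hST n hn x hx
      rw [inner_rtMap_normal hd hT hS.1.2 hST _ _ hn hx.1, h2 S hS ⟨x, hx⟩ T hT hST, mul_zero]

lemma isCR_add_smul {ΓD : Set (E d)} {p w : Finset (E d) → (E d →ᵃ[ℝ] ℝ)} (hp : 𝒯.IsCR ΓD p)
    (hw : 𝒯.IsCR ΓD w) (t : ℝ) : 𝒯.IsCR ΓD (fun T => p T + t • w T) := by
  constructor
  · intro S hS T hT T' hT' hST hST'
    simp [hp.1 S hS T hT T' hT' hST hST', hw.1 S hS T hT T' hT' hST hST']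
  · intro S hS hSD T hT hST
    simp [hp.2 S hS hSD T hT hST, hw.2 S hS hSD T hT hST]

lemma isRT_add_smul {ΓN : Set (E d)} {a a' : Finset (E d) → E d} {b b' : Finset (E d) → ℝ}
    (h : 𝒯.IsRT ΓN a b) (h' : 𝒯.IsRT ΓN a' b') (t : ℝ) :
    𝒯.IsRT ΓN (fun T => a T + t • a' T) (fun T => b T + t * b' T) := by
  constructor
  · intro S hS T hT T' hT' hne hST hST'
    rw [flux_add_smul, flux_add_smul]
    linear_combination h.1 S hS T hT T' hT' hne hST hST'
      + t * h'.1 S hS T hT T' hT' hne hST hST'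
  · intro S hS hSN T hT hST
    rw [flux_add_smul, h.2 S hS hSN T hT hST, h'.2 S hS hSN T hT hST]
    ring

/-! ### Discrete integration by parts -/

/-- The integral of `⟨y, ∇_h v⟩ + Π_h v div y` over the domain as a sum over the sides. -/
lemma sum_vol_mul_eq (hd : 1 ≤ d) (p : Finset (E d) → (E d →ᵃ[ℝ] ℝ)) (a : Finset (E d) → E d)
    (b : Finset (E d) → ℝ) :
    ∑ T ∈ 𝒯.elements, vol T * (inner ℝ (a T) (agrad (p T)) + d * b T * p T (center T))
      = d * ∑ S ∈ 𝒯.elements.biUnion (Finset.powersetCard d),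
        ∑ T ∈ 𝒯.elements with S ⊆ T, p T (barycenter S) * flux T S (a T) (b T) := by
  rw [Finset.sum_congr rfl fun T hT => (isCell hT).vol_mul_eq_sum_flux hd (p T) (a T) (b T),
    ← Finset.mul_sum]
  congr 1
  apply Finset.sum_comm'
  intro T S
  simp only [Finset.mem_powersetCard, Finset.mem_filter, Finset.mem_biUnion]
  constructor
  · rintro ⟨hT, hST, hS⟩
    exact ⟨⟨hT, hST⟩, T, hT, hST, hS⟩
  · rintro ⟨⟨hT, hST⟩, _, _, _, hS⟩
    exact ⟨hT, hST, hS⟩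

/-- A side of an element is a boundary side, or belongs to exactly one further element. -/
lemma side_cases (hd : 1 ≤ d) {S T : Finset (E d)} (hS : S.card = d) (hT : T ∈ 𝒯.elements)
    (hST : S ⊆ T) :
    (S ∈ 𝒯.boundarySides ∧ {T ∈ 𝒯.elements | S ⊆ T} = {T}) ∨
    ∃ T' ∈ 𝒯.elements, T ≠ T' ∧ S ⊆ T' ∧ {T ∈ 𝒯.elements | S ⊆ T} = {T, T'} := by
  by_cases h : ∃ T' ∈ 𝒯.elements, T ≠ T' ∧ S ⊆ T'
  · right
    obtain ⟨T', hT', hne, hST'⟩ := h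
    refine ⟨T', hT', hne, hST', ?_⟩
    ext T''
    simp only [Finset.mem_filter, Finset.mem_insert, Finset.mem_singleton]
    constructor
    · rintro ⟨hT'', hST''⟩
      exact eq_or_eq_of_side_subset hd hT hT' hT'' hne hS hST hST' hST''
    · rintro (rfl | rfl)
      · exact ⟨hT, hST⟩
      · exact ⟨hT', hST'⟩
  · left
    push Not at h
    have huniq : ∀ T' ∈ 𝒯.elements, S ⊆ T' → T' = T := fun T' hT' hST' => by
      by_contra hne
      exact h T' hT' (Ne.symm hne) hST'
    refine ⟨⟨side_of_subset hd hT hST hS, T, ⟨hT, hST⟩, fun T' h' => huniq T' h'.1 h'.2⟩, ?_⟩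
    ext T'
    simp only [Finset.mem_filter, Finset.mem_singleton]
    constructor
    · exact fun h' => huniq T' h'.1 h'.2
    · rintro rfl
      exact ⟨hT, hST⟩

/-- The discrete integration by parts formula. A boundary side either is contained in `ΓD` or meets
`ΓN`. -/
lemma parts (hd : 1 ≤ d) (hΩ : interior (closure Ω) = Ω) {ΓD ΓN : Set (E d)}
    (hΓ : ΓD ∪ ΓN = frontier Ω) {p : Finset (E d) → (E d →ᵃ[ℝ] ℝ)} {a : Finset (E d) → E d}
    {b : Finset (E d) → ℝ} (hp : 𝒯.IsCR ΓD p) (hab : 𝒯.IsRT ΓN a b) :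
    ∑ T ∈ 𝒯.elements, vol T * (inner ℝ (a T) (agrad (p T)) + d * b T * p T (center T)) = 0 := by
  rw [sum_vol_mul_eq hd]
  refine mul_eq_zero_of_right _ (Finset.sum_eq_zero fun S hS => ?_)
  obtain ⟨T, hT, hTS⟩ := Finset.mem_biUnion.1 hS
  obtain ⟨hST, hS⟩ := Finset.mem_powersetCard.1 hTS
  rcases side_cases hd hS hT hST with ⟨hb, hf⟩ | ⟨T', hT', hne, hST', hf⟩
  · rw [hf, Finset.sum_singleton]
    by_cases hD : convexHull ℝ (S : Set (E d)) ⊆ ΓD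
    · rw [hp.2 S hb hD T hT hST, zero_mul]
    · obtain ⟨x, hx, hxD⟩ := not_subset.1 hD
      have hxf := boundarySide_subset_frontier hd (hΩ ▸ isOpen_interior) hb hx
      rw [← hΓ] at hxf
      rw [hab.2 S hb ⟨x, hx, hxf.resolve_left hxD⟩ T hT hST, mul_zero]
  · have hs := side_of_subset hd hT hST hS
    rw [hf, Finset.sum_pair hne, hp.1 S hs T hT T' hT' hST hST', ← mul_add,
      hab.1 S hs T hT T' hT' hne hST hST', mul_zero]

/-! ### Basis functions -/

/-- The Crouzeix--Raviart function that is one at the barycenter of the side `S` and zero at the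
barycenters of all other sides. -/
noncomputable def crBasis (S T : Finset (E d)) : E d →ᵃ[ℝ] ℝ :=
  if S ⊆ T then AffineMap.const ℝ (E d) 1 - (d : ℝ) • ∑ z ∈ T \ S, bary T z else 0

lemma crBasis_barycenter (hd : 1 ≤ d) {S S' T : Finset (E d)} (hT : T ∈ 𝒯.elements)
    (hS : S.card = d) (hS' : S'.card = d) (hST' : S' ⊆ T) :
    crBasis S T (barycenter S') = if S = S' then 1 else 0 := by
  by_cases hST : S ⊆ T
  · have cT := isCell hT
    obtain ⟨z, hz, rfl⟩ := cT.exists_erase hS hST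
    rw [crBasis, if_pos hST, Finset.sdiff_erase_self hz, Finset.sum_singleton]
    have hd' : (d : ℝ) ≠ 0 := by positivity
    by_cases hSS : T.erase z = S'
    · subst hSS
      have h0 := cT.bary_eq_zero_of_mem hz hST' (by simp) (barycenter_mem hd hS)
      simp [h0]
    · have hzS' : z ∈ S' := by
        by_contra hzS'
        refine hSS (Finset.eq_of_subset_of_card_le (fun w hw => ?_) (by rw [hS, hS'])).symm
        exact Finset.mem_erase.2 ⟨fun h => hzS' (h ▸ hw), hST' hw⟩
      have h1 : bary T z (barycenter S') = (d : ℝ)⁻¹ := by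
        rw [affine_barycenter hd _ hS', Finset.sum_eq_single_of_mem z hzS'
          (fun v hv hne => cT.bary_of_ne hz (hST' hv) hne), cT.bary_self hz]
        simp
      simp [h1, hSS, hd']
  · have hSS : S ≠ S' := fun h => hST (h ▸ hST')
    simp [crBasis, hST, hSS]

lemma isCR_crBasis (hd : 1 ≤ d) {ΓD : Set (E d)} {S : Finset (E d)} (hS : S.card = d)
    (hD : S ∈ 𝒯.boundarySides → ¬ convexHull ℝ (S : Set (E d)) ⊆ ΓD) :
    𝒯.IsCR ΓD (crBasis S) := by
  constructor
  · intro S' hS' T hT T' hT' hST hST'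
    rw [crBasis_barycenter hd hT hS hS'.2 hST, crBasis_barycenter hd hT' hS hS'.2 hST']
  · intro S' hS' hSD T hT hST
    rw [crBasis_barycenter hd hT hS hS'.1.2 hST, if_neg]
    rintro rfl
    exact hD hS' hSD

/-- The mean values of the field `σ_T / |T| (x - z)`, for the vertex `z` of `T` opposite to `S`, which
has flux `σ_T` through `S` and no flux through the other sides of `T`. -/
noncomputable def rtBasisMean (S : Finset (E d)) (σ : Finset (E d) → ℝ) (T : Finset (E d)) : E d :=
  if S ⊆ T then (σ T / vol T) • (center T - ∑ z ∈ T \ S, z) else 0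

/-- The divergence, divided by `d`, of the field `σ_T / |T| (x - z)`. -/
noncomputable def rtBasisDiv (S : Finset (E d)) (σ : Finset (E d) → ℝ) (T : Finset (E d)) : ℝ :=
  if S ⊆ T then σ T / vol T else 0

lemma flux_rtBasis (hd : 1 ≤ d) {S S' T : Finset (E d)} (σ : Finset (E d) → ℝ)
    (hT : T ∈ 𝒯.elements) (hS : S.card = d) (hS' : S'.card = d) (hST' : S' ⊆ T) :
    flux T S' (rtBasisMean S σ T) (rtBasisDiv S σ T) = if S = S' then σ T else 0 := by
  by_cases hST : S ⊆ T
  · have cT := isCell hT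
    have hv := cT.vol_pos.ne'
    obtain ⟨z, hz, rfl⟩ := cT.exists_erase hS hST
    obtain ⟨w, hw, rfl⟩ := cT.exists_erase hS' hST'
    have hx := barycenter_mem hd hS'
    rw [← cT.inner_sideVec hS' hST' _ _ hx, rtBasisMean, rtBasisDiv, if_pos hST, if_pos hST,
      Finset.sdiff_erase_self hz, Finset.sum_singleton, ← smul_add, sub_add_sub_cancel',
      sideVec_erase hw, real_inner_smul_left, real_inner_smul_right, real_inner_comm,
      inner_agrad_sub, cT.bary_eq_zero_of_mem hw hST' (by simp) hx]
    by_cases hzw : z = w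
    · subst hzw
      rw [cT.bary_self hz, if_pos rfl]
      field_simp
      ring
    · rw [cT.bary_of_ne hw hz hzw, if_neg fun h => hzw ((Finset.erase_inj T hz).1 h)]
      ring
  · have hSS : S ≠ S' := fun h => hST (h ▸ hST')
    simp [rtBasisMean, rtBasisDiv, hST, hSS, flux]

lemma isRT_rtBasis (hd : 1 ≤ d) {ΓN : Set (E d)} {S : Finset (E d)} (hS : S.card = d)
    (σ : Finset (E d) → ℝ)
    (h1 : ∀ T ∈ 𝒯.elements, ∀ T' ∈ 𝒯.elements, T ≠ T' → S ⊆ T → S ⊆ T' → σ T + σ T' = 0)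
    (h2 : S ∈ 𝒯.boundarySides → ¬ (convexHull ℝ (S : Set (E d)) ∩ ΓN).Nonempty) :
    𝒯.IsRT ΓN (rtBasisMean S σ) (rtBasisDiv S σ) := by
  constructor
  · intro S' hS' T hT T' hT' hne hST hST'
    rw [flux_rtBasis hd σ hT hS hS'.2 hST, flux_rtBasis hd σ hT' hS hS'.2 hST']
    split_ifs with h
    · subst h
      exact h1 T hT T' hT' hne hST hST'
    · simp
  · intro S' hS' hSN T hT hST
    rw [flux_rtBasis hd σ hT hS hS'.1.2 hST, if_neg]
    rintro rfl
    exact h2 hS' hSN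

/-- Orthogonality to the Crouzeix--Raviart space characterizes the Raviart--Thomas space. -/
lemma isRT_of_orthogonal (hd : 1 ≤ d) {ΓD ΓN : Set (E d)} (hdisj : Disjoint ΓD ΓN)
    {a : Finset (E d) → E d} {b : Finset (E d) → ℝ}
    (h : ∀ w, 𝒯.IsCR ΓD w → ∑ T ∈ 𝒯.elements,
      vol T * (inner ℝ (a T) (agrad (w T)) + d * b T * w T (center T)) = 0) :
    𝒯.IsRT ΓN a b := by
  have key : ∀ S T, S.card = d → T ∈ 𝒯.elements → S ⊆ T →
      (S ∈ 𝒯.boundarySides → ¬ convexHull ℝ (S : Set (E d)) ⊆ ΓD) →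
      ∑ T ∈ 𝒯.elements with S ⊆ T, flux T S (a T) (b T) = 0 := by
    intro S T hS hT hST hD
    have h1 := h _ (isCR_crBasis hd hS hD)
    rw [sum_vol_mul_eq hd, Finset.sum_eq_single_of_mem S
      (Finset.mem_biUnion.2 ⟨T, hT, Finset.mem_powersetCard.2 ⟨hST, hS⟩⟩)] at h1
    · have hd' : (d : ℝ) ≠ 0 := by positivity
      rw [← (mul_eq_zero.1 h1).resolve_left hd']
      refine Finset.sum_congr rfl fun T' hT' => ?_
      obtain ⟨hT', hST'⟩ := Finset.mem_filter.1 hT'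
      rw [crBasis_barycenter hd hT' hS hS hST', if_pos rfl, one_mul]
    · intro S' hS' hne
      obtain ⟨_, _, hS'⟩ := Finset.mem_biUnion.1 hS'
      refine Finset.sum_eq_zero fun T' hT' => ?_
      obtain ⟨hT', hST'⟩ := Finset.mem_filter.1 hT'
      rw [crBasis_barycenter hd hT' hS (Finset.mem_powersetCard.1 hS').2 hST', if_neg hne.symm,
        zero_mul]
  constructor
  · intro S hS T hT T' hT' hne hST hST'
    rcases side_cases hd hS.2 hT hST with ⟨hb, hf⟩ | ⟨T'', hT'', hne'', hST'', hf⟩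
    · have : T' ∈ ({T} : Finset (Finset (E d))) := hf ▸ Finset.mem_filter.2 ⟨hT', hST'⟩
      exact absurd (Finset.mem_singleton.1 this).symm hne
    · have : T' ∈ ({T, T''} : Finset (Finset (E d))) := hf ▸ Finset.mem_filter.2 ⟨hT', hST'⟩
      obtain rfl : T' = T'' := by
        rcases Finset.mem_insert.1 this with h | h
        · exact absurd h.symm hne
        · exact Finset.mem_singleton.1 h
      have := key S T hS.2 hT hST fun hb =>
        absurd (hb.2.unique ⟨hT, hST⟩ ⟨hT', hST'⟩) hne
      rwa [hf, Finset.sum_pair hne] at this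
  · rintro S hS ⟨x, hx, hxN⟩ T hT hST
    have := key S T hS.1.2 hT hST fun _ hD => Set.disjoint_left.1 hdisj (hD hx) hxN
    rcases side_cases hd hS.1.2 hT hST with ⟨hb, hf⟩ | ⟨T', hT', hne, hST', hf⟩
    · rwa [hf, Finset.sum_singleton] at this
    · exact absurd (hS.2.unique ⟨hT, hST⟩ ⟨hT', hST'⟩) hne

/-- Orthogonality to the Raviart--Thomas space characterizes the Crouzeix--Raviart space. -/
lemma isCR_of_orthogonal (hd : 1 ≤ d) {ΓD ΓN : Set (E d)} (hdisj : Disjoint ΓD ΓN)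
    {p : Finset (E d) → (E d →ᵃ[ℝ] ℝ)}
    (h : ∀ a b, 𝒯.IsRT ΓN a b → ∑ T ∈ 𝒯.elements,
      vol T * (inner ℝ (a T) (agrad (p T)) + d * b T * p T (center T)) = 0) :
    𝒯.IsCR ΓD p := by
  have key : ∀ S T, S.card = d → T ∈ 𝒯.elements → S ⊆ T → ∀ σ : Finset (E d) → ℝ,
      (∀ T ∈ 𝒯.elements, ∀ T' ∈ 𝒯.elements, T ≠ T' → S ⊆ T → S ⊆ T' → σ T + σ T' = 0) →
      (S ∈ 𝒯.boundarySides → ¬ (convexHull ℝ (S : Set (E d)) ∩ ΓN).Nonempty) →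
      ∑ T ∈ 𝒯.elements with S ⊆ T, p T (barycenter S) * σ T = 0 := by
    intro S T hS hT hST σ hσ hN
    have h1 := h _ _ (isRT_rtBasis hd hS σ hσ hN)
    rw [sum_vol_mul_eq hd, Finset.sum_eq_single_of_mem S
      (Finset.mem_biUnion.2 ⟨T, hT, Finset.mem_powersetCard.2 ⟨hST, hS⟩⟩)] at h1
    · have hd' : (d : ℝ) ≠ 0 := by positivity
      rw [← (mul_eq_zero.1 h1).resolve_left hd']
      refine Finset.sum_congr rfl fun T' hT' => ?_
      obtain ⟨hT', hST'⟩ := Finset.mem_filter.1 hT'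
      rw [flux_rtBasis hd σ hT' hS hS hST', if_pos rfl]
    · intro S' hS' hne
      obtain ⟨_, _, hS'⟩ := Finset.mem_biUnion.1 hS'
      refine Finset.sum_eq_zero fun T' hT' => ?_
      obtain ⟨hT', hST'⟩ := Finset.mem_filter.1 hT'
      rw [flux_rtBasis hd σ hT' hS (Finset.mem_powersetCard.1 hS').2 hST', if_neg hne.symm,
        mul_zero]
  constructor
  · intro S hS T hT T' hT' hST hST'
    by_cases hne : T = T'
    · rw [hne]
    rcases side_cases hd hS.2 hT hST with ⟨hb, hf⟩ | ⟨T'', hT'', hne'', hST'', hf⟩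
    · have : T' ∈ ({T} : Finset (Finset (E d))) := hf ▸ Finset.mem_filter.2 ⟨hT', hST'⟩
      exact absurd (Finset.mem_singleton.1 this).symm hne
    · have hmem : ∀ T₁ ∈ 𝒯.elements, S ⊆ T₁ → T₁ = T ∨ T₁ = T'' := fun T₁ h₁ h₂ => by
        have : T₁ ∈ ({T, T''} : Finset (Finset (E d))) := hf ▸ Finset.mem_filter.2 ⟨h₁, h₂⟩
        simpa using this
      obtain rfl : T' = T'' := (hmem T' hT' hST').resolve_left (Ne.symm hne)
      have := key S T hS.2 hT hST (fun T₁ => if T₁ = T then 1 else -1) (by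
        intro T₁ h₁ T₂ h₂ h12 hS₁ hS₂
        rcases hmem T₁ h₁ hS₁ with rfl | rfl <;> rcases hmem T₂ h₂ hS₂ with rfl | rfl
        · exact absurd rfl h12
        · simp [Ne.symm hne]
        · simp [Ne.symm hne]
        · exact absurd rfl h12) fun hb => absurd (hb.2.unique ⟨hT, hST⟩ ⟨hT', hST'⟩) hne
      rw [hf, Finset.sum_pair hne, if_pos rfl, if_neg (Ne.symm hne)] at this
      linarith
  · intro S hS hD T hT hST
    have := key S T hS.1.2 hT hST (fun _ => 1)
      (fun T₁ h₁ T₂ h₂ hne hS₁ hS₂ => absurd (hS.2.unique ⟨h₁, hS₁⟩ ⟨h₂, hS₂⟩) hne)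
      (fun _ ⟨x, hx, hxN⟩ => Set.disjoint_left.1 hdisj (hD hx) hxN)
    rcases side_cases hd hS.1.2 hT hST with ⟨hb, hf⟩ | ⟨T', hT', hne, hST', hf⟩
    · rw [hf, Finset.sum_singleton] at this
      linarith
    · exact absurd (hS.2.unique ⟨hT, hST⟩ ⟨hT', hST'⟩) hne

end Triangulation

/-! ### Weak duality and optimality conditions -/

lemma IsC1.hasDerivAt_line {H : Type*} [NormedAddCommGroup H] [InnerProductSpace ℝ H]
    [CompleteSpace H] {f : H → EReal} (hf : IsC1 f) (x v : H) :
    HasDerivAt (fun t : ℝ => (f (x + t • v)).toReal) (inner ℝ (D f x) v) 0 := by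
  have h1 : HasFDerivAt (fun x => (f x).toReal) ((InnerProductSpace.toDual ℝ H) (D f x))
      (x + (0 : ℝ) • v) := by
    simpa using (hf.hasGradientAt x).hasFDerivAt
  have h2 : HasDerivAt (fun t : ℝ => x + t • v) v 0 := by
    simpa using ((hasDerivAt_id (0 : ℝ)).smul_const v).const_add x
  have h := h1.comp_hasDerivAt (0 : ℝ) h2
  rw [InnerProductSpace.toDual_apply_apply] at h
  exact h

/-- The first order optimality condition for a sum of differentiable functions. -/
lemma sum_inner_D_eq_zero {ι H : Type*} [NormedAddCommGroup H] [InnerProductSpace ℝ H]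
    [CompleteSpace H] (s : Finset ι) (c : ι → ℝ) {f : H → EReal} {g : ι → ℝ → EReal}
    (hf : IsC1 f) (hg : ∀ i ∈ s, IsC1 (g i)) (x v : ι → H) (r w : ι → ℝ)
    (hmin : ∀ t : ℝ, ∑ i ∈ s, c i * ((f (x i)).toReal + (g i (r i)).toReal)
      ≤ ∑ i ∈ s, c i * ((f (x i + t • v i)).toReal + (g i (r i + t * w i)).toReal)) :
    ∑ i ∈ s, c i * (inner ℝ (D f (x i)) (v i) + D (g i) (r i) * w i) = 0 := by
  have hd : HasDerivAt
      (fun t : ℝ => ∑ i ∈ s, c i * ((f (x i + t • v i)).toReal + (g i (r i + t * w i)).toReal))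
      (∑ i ∈ s, c i * (inner ℝ (D f (x i)) (v i) + D (g i) (r i) * w i)) 0 := by
    refine HasDerivAt.fun_sum fun i hi => ?_
    have h2 := (hg i hi).hasDerivAt_line (r i) (w i)
    rw [show (inner ℝ (D (g i) (r i)) (w i) : ℝ) = D (g i) (r i) * w i by simp [mul_comm]] at h2
    exact ((hf.hasDerivAt_line (x i) (v i)).add h2).const_mul (c i)
  refine IsLocalMin.hasDerivAt_eq_zero (Filter.Eventually.of_forall fun t => ?_) hd
  simpa using hmin t

namespace Triangulation

variable {Ω : Set (E d)} {𝒯 : Triangulation d Ω} {φ : E d → EReal}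
  {ψ : E d → ℝ → EReal} {g : Finset (E d) → ℝ → EReal}

lemma of_ae_domain (hΩ : interior (closure Ω) = Ω)
    (hψg : ∀ T ∈ 𝒯.elements,
      ∀ᵐ x ∂(volume.restrict (interior (convexHull ℝ (T : Set (E d))))), ψ x = g T)
    {P : (ℝ → EReal) → Prop} (hP : ∀ᵐ x ∂(volume.restrict Ω), P (ψ x)) :
    ∀ T ∈ 𝒯.elements, P (g T) := by
  intro T hT
  have h1 := (ae_domain_iff (𝒯 := 𝒯) hΩ).1 hP T hT
  have hne : volume (interior (convexHull ℝ (T : Set (E d)))) ≠ 0 := by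
    rw [measure_interior]
    exact (ENNReal.ofReal_pos.2 (isCell hT).vol_pos).ne'
  have : (ae (volume.restrict (interior (convexHull ℝ (T : Set (E d)))))).NeBot := by
    rw [ae_neBot, Ne, Measure.restrict_eq_zero]
    exact hne
  obtain ⟨x, hx1, hx2⟩ := (h1.and (hψg T hT)).exists
  exact hx2 ▸ hx1

/-- The dual functional is a lower bound for the primal functional: integrate the Fenchel--Young
inequalities and use the discrete integration by parts formula. -/
lemma dual_le_primal (hd : 1 ≤ d) (hΩ : interior (closure Ω) = Ω) {ΓD ΓN : Set (E d)}
    (hΓ : ΓD ∪ ΓN = frontier Ω) (hφ : ProperConvexLSC φ)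
    (hg : ∀ T ∈ 𝒯.elements, ProperConvexLSC (g T))
    (hψg : ∀ T ∈ 𝒯.elements,
      ∀ᵐ x ∂(volume.restrict (interior (convexHull ℝ (T : Set (E d))))), ψ x = g T)
    {v : E d → ℝ} (hv : v ∈ 𝒯.crSpace ΓD) {y : E d → E d} (hy : y ∈ 𝒯.rtSpace ΓN) :
    dual 𝒯 φ ψ y ≤ primal 𝒯 φ ψ v := by
  obtain ⟨p, hvp, hp⟩ := mem_crSpace_iff.1 hv
  obtain ⟨a, b, hyab, hab⟩ := (mem_rtSpace_iff hd).1 hy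
  rcases primal_cases hΩ hφ hg hψg hvp with ⟨f1, e1⟩ | ⟨-, e1⟩
  · rcases dual_cases hΩ hφ hg hψg hyab with ⟨f2, e2⟩ | ⟨-, e2⟩
    · rw [e1, e2, EReal.coe_le_coe_iff]
      have h := parts hd hΩ hΓ hp hab
      rw [neg_le_iff_add_nonneg, ← Finset.sum_add_distrib]
      rw [← h]
      refine Finset.sum_le_sum fun T hT => ?_
      rw [← mul_add]
      refine mul_le_mul_of_nonneg_left ?_ (isCell hT).vol_pos.le
      have i1 := inner_le_add hφ.ne_bot (EReal.coe_toReal (f1 T hT).1 (hφ.ne_bot _)).symm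
        (EReal.coe_toReal (f2 T hT).1 (conj_ne_bot hφ _)).symm
      have i2 := inner_le_add (hg T hT).ne_bot
        (EReal.coe_toReal (f1 T hT).2 ((hg T hT).ne_bot _)).symm
        (EReal.coe_toReal (f2 T hT).2 (conj_ne_bot (hg T hT) _)).symm
      have i3 : (inner ℝ (d * b T) (p T (center T)) : ℝ) = d * b T * p T (center T) := by
        simp [mul_comm]
      linarith
    · rw [e2]; exact bot_le
  · rw [e1]; exact le_top

/-- Equality of the functionals for pairs of functions with equality in the Fenchel--Young
inequalities. -/
lemma primal_eq_dual (hd : 1 ≤ d) (hΩ : interior (closure Ω) = Ω) {ΓD ΓN : Set (E d)}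
    (hΓ : ΓD ∪ ΓN = frontier Ω) (hφ : ProperConvexLSC φ)
    (hg : ∀ T ∈ 𝒯.elements, ProperConvexLSC (g T))
    (hψg : ∀ T ∈ 𝒯.elements,
      ∀ᵐ x ∂(volume.restrict (interior (convexHull ℝ (T : Set (E d))))), ψ x = g T)
    {v : E d → ℝ} {p : Finset (E d) → (E d →ᵃ[ℝ] ℝ)} (hv : 𝒯.IsPiecewise v p)
    (hp : 𝒯.IsCR ΓD p) {y : E d → E d} {a : Finset (E d) → E d} {b : Finset (E d) → ℝ}
    (hy : 𝒯.IsPiecewise y (fun T => rtMap T (a T) (b T))) (hab : 𝒯.IsRT ΓN a b)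
    (h1 : ∀ T ∈ 𝒯.elements, ∃ r s : ℝ, φ (agrad (p T)) = r ∧ conj φ (a T) = s ∧
      r + s = inner ℝ (a T) (agrad (p T)))
    (h2 : ∀ T ∈ 𝒯.elements, ∃ r s : ℝ, g T (p T (center T)) = r ∧ conj (g T) (d * b T) = s ∧
      r + s = d * b T * p T (center T)) :
    primal 𝒯 φ ψ v = dual 𝒯 φ ψ y := by
  rcases primal_cases hΩ hφ hg hψg hv with ⟨-, e1⟩ | ⟨⟨T, hT, h⟩, -⟩
  · rcases dual_cases hΩ hφ hg hψg hy with ⟨-, e2⟩ | ⟨⟨T, hT, h⟩, -⟩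
    · rw [e1, e2, EReal.coe_eq_coe_iff, eq_neg_iff_add_eq_zero, ← Finset.sum_add_distrib,
        ← parts hd hΩ hΓ hp hab]
      refine Finset.sum_congr rfl fun T hT => ?_
      obtain ⟨r, s, hr, hs, hrs⟩ := h1 T hT
      obtain ⟨r', s', hr', hs', hrs'⟩ := h2 T hT
      rw [hr, hs, hr', hs', ← hrs, ← hrs']
      simp only [EReal.toReal_coe]
      ring
    · obtain ⟨r, s, hr, hs, hrs⟩ := h1 T hT
      obtain ⟨r', s', hr', hs', hrs'⟩ := h2 T hT
      rw [hs, hs'] at h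
      rcases h with h | h <;> exact absurd h (EReal.coe_ne_top _)
  · obtain ⟨r, s, hr, hs, hrs⟩ := h1 T hT
    obtain ⟨r', s', hr', hs', hrs'⟩ := h2 T hT
    rw [hr, hr'] at h
    rcases h with h | h <;> exact absurd h (EReal.coe_ne_top _)

/-- The formula for a maximizer of the dual functional in terms of a minimizer of the primal
functional. -/
theorem exists_dual_solution (hd : 1 ≤ d) (hΩ : interior (closure Ω) = Ω) {ΓD ΓN : Set (E d)}
    (hΓ : ΓD ∪ ΓN = frontier Ω) (hdisj : Disjoint ΓD ΓN) (hφ : ProperConvexLSC φ)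
    (hg : ∀ T ∈ 𝒯.elements, ProperConvexLSC (g T))
    (hψg : ∀ T ∈ 𝒯.elements,
      ∀ᵐ x ∂(volume.restrict (interior (convexHull ℝ (T : Set (E d))))), ψ x = g T)
    (hφ1 : IsC1 φ) (hg1 : ∀ T ∈ 𝒯.elements, IsC1 (g T)) {u : E d → ℝ} (hu : u ∈ 𝒯.crSpace ΓD)
    (hmin : IsMinOn (primal 𝒯 φ ψ) (𝒯.crSpace ΓD) u) :
    ∃ z ∈ 𝒯.rtSpace ΓN,
      (∀ᵐ x ∂(volume.restrict Ω), z x = D φ (gradh u x)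
        + (D (ψ x) (𝒯.proj u x) / (d : ℝ)) • (x - 𝒯.proj id x)) ∧
      IsMaxOn (dual 𝒯 φ ψ) (𝒯.rtSpace ΓN) z ∧ primal 𝒯 φ ψ u = dual 𝒯 φ ψ z := by
  have hd' : (d : ℝ) ≠ 0 := by positivity
  obtain ⟨p, hup, hp⟩ := mem_crSpace_iff.1 hu
  set a : Finset (E d) → E d := fun T => D φ (agrad (p T)) with ha
  set b : Finset (E d) → ℝ := fun T => D (g T) (p T (center T)) / d with hb
  have hdb : ∀ T, d * b T = D (g T) (p T (center T)) := fun T => mul_div_cancel₀ _ hd'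
  have primal_eq : ∀ {v : E d → ℝ} {q : Finset (E d) → (E d →ᵃ[ℝ] ℝ)}, 𝒯.IsPiecewise v q →
      primal 𝒯 φ ψ v = ((∑ T ∈ 𝒯.elements, vol T *
        ((φ (agrad (q T))).toReal + (g T (q T (center T))).toReal) : ℝ) : EReal) := by
    intro v q hv
    rcases primal_cases hΩ hφ hg hψg hv with ⟨-, e⟩ | ⟨⟨T, hT, h⟩, -⟩
    · exact e
    · rcases h with h | h
      · exact absurd h (hφ1.1 _).1
      · exact absurd h ((hg1 T hT).1 _).1
  have hRT : 𝒯.IsRT ΓN a b := by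
    refine isRT_of_orthogonal hd hdisj fun w hw => ?_
    simp_rw [hdb]
    refine sum_inner_D_eq_zero 𝒯.elements vol hφ1 hg1 (fun T => agrad (p T))
      (fun T => agrad (w T)) (fun T => p T (center T)) (fun T => w T (center T)) fun t => ?_
    have hpw := isPiecewise_piecewise (𝒯 := 𝒯) (fun T => p T + t • w T)
    have h := isMinOn_iff.1 hmin _ (mem_crSpace_iff.2 ⟨_, hpw, isCR_add_smul hp hw t⟩)
    rw [primal_eq hup, primal_eq hpw, EReal.coe_le_coe_iff] at h
    have hadd : ∀ T, agrad (p T + t • w T) = agrad (p T) + t • agrad (w T) := fun T => by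
      simp [agrad]
    simpa [hadd] using h
  have hz := isPiecewise_piecewise (𝒯 := 𝒯) (fun T => rtMap T (a T) (b T))
  have hzmem := (mem_rtSpace_iff hd).2 ⟨a, b, hz, hRT⟩
  have heq : primal 𝒯 φ ψ u = dual 𝒯 φ ψ (𝒯.piecewise fun T => rtMap T (a T) (b T)) := by
    refine primal_eq_dual hd hΩ hΓ hφ hg hψg hup hp hz hRT (fun T hT => ?_) (fun T hT => ?_)
    · exact ⟨_, _, (hφ1.coe_toReal _).symm, conj_D hφ hφ1 _, by ring⟩
    · rw [hdb]
      refine ⟨_, _, ((hg1 T hT).coe_toReal _).symm, conj_D (hg T hT) (hg1 T hT) _, ?_⟩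
      simp [mul_comm]
  refine ⟨_, hzmem, ?_, ?_, heq⟩
  · rw [ae_domain_iff (𝒯 := 𝒯) hΩ]
    intro T hT
    filter_upwards [hψg T hT, ae_restrict_mem isOpen_interior.measurableSet] with x hx hxT
    rw [hz T hT hxT, rtMap_apply, hx, gradh_eq hup hT hxT, proj_eq hup hT hxT, proj_id hT hxT]
  · exact isMaxOn_iff.2 fun y hy => heq ▸ dual_le_primal hd hΩ hΓ hφ hg hψg hu hy

/-- The formula for a minimizer of the primal functional in terms of a maximizer of the dual
functional. -/
theorem exists_primal_solution (hd : 1 ≤ d) (hΩ : interior (closure Ω) = Ω) {ΓD ΓN : Set (E d)}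
    (hΓ : ΓD ∪ ΓN = frontier Ω) (hdisj : Disjoint ΓD ΓN) (hφ : ProperConvexLSC φ)
    (hg : ∀ T ∈ 𝒯.elements, ProperConvexLSC (g T))
    (hψg : ∀ T ∈ 𝒯.elements,
      ∀ᵐ x ∂(volume.restrict (interior (convexHull ℝ (T : Set (E d))))), ψ x = g T)
    (hφ1 : IsC1 (conj φ)) (hg1 : ∀ T ∈ 𝒯.elements, IsC1 (conj (g T))) {z : E d → E d}
    (hzmem : z ∈ 𝒯.rtSpace ΓN) (hmax : IsMaxOn (dual 𝒯 φ ψ) (𝒯.rtSpace ΓN) z) :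
    ∃ u ∈ 𝒯.crSpace ΓD,
      (∀ᵐ x ∂(volume.restrict Ω), u x = D (conj (ψ x)) (divh z x)
        + inner ℝ (D (conj φ) (𝒯.proj z x)) (x - 𝒯.proj id x)) ∧
      IsMinOn (primal 𝒯 φ ψ) (𝒯.crSpace ΓD) u ∧ primal 𝒯 φ ψ u = dual 𝒯 φ ψ z := by
  obtain ⟨a, b, hz, hab⟩ := (mem_rtSpace_iff hd).1 hzmem
  set q : Finset (E d) → E d := fun T => D (conj φ) (a T) with hq
  set s : Finset (E d) → ℝ := fun T => D (conj (g T)) (d * b T) with hs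
  have dual_eq : ∀ {y : E d → E d} {α : Finset (E d) → E d} {β : Finset (E d) → ℝ},
      𝒯.IsPiecewise y (fun T => rtMap T (α T) (β T)) →
      dual 𝒯 φ ψ y = ((-∑ T ∈ 𝒯.elements, vol T *
        ((conj φ (α T)).toReal + (conj (g T) (d * β T)).toReal) : ℝ) : EReal) := by
    intro y α β hy
    rcases dual_cases hΩ hφ hg hψg hy with ⟨-, e⟩ | ⟨⟨T, hT, h⟩, -⟩
    · exact e
    · rcases h with h | h
      · exact absurd h (hφ1.1 _).1
      · exact absurd h ((hg1 T hT).1 _).1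
  have hCR : 𝒯.IsCR ΓD (fun T => crMap T (q T) (s T)) := by
    refine isCR_of_orthogonal hd hdisj (ΓN := ΓN) fun α β hαβ => ?_
    have h0 := sum_inner_D_eq_zero 𝒯.elements vol hφ1 hg1 a α (fun T => d * b T)
      (fun T => d * β T) fun t => by
        have hpw := isPiecewise_piecewise (𝒯 := 𝒯)
          (fun T => rtMap T (a T + t • α T) (b T + t * β T))
        have h := isMaxOn_iff.1 hmax _
          ((mem_rtSpace_iff hd).2 ⟨_, _, hpw, isRT_add_smul hab hαβ t⟩)
        rw [dual_eq hz, dual_eq hpw, EReal.coe_le_coe_iff, neg_le_neg_iff] at h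
        have e : ∀ T, d * (b T + t * β T) = d * b T + t * (d * β T) := fun T => by ring
        simpa only [e] using h
    rw [← h0]
    refine Finset.sum_congr rfl fun T _ => ?_
    rw [agrad_crMap, crMap_center, real_inner_comm, mul_comm (d * β T)]
  have hu := isPiecewise_piecewise (𝒯 := 𝒯) (fun T => crMap T (q T) (s T))
  have humem := mem_crSpace_iff.2 ⟨_, hu, hCR⟩
  have heq : primal 𝒯 φ ψ (𝒯.piecewise fun T => crMap T (q T) (s T)) = dual 𝒯 φ ψ z := by
    refine primal_eq_dual hd hΩ hΓ hφ hg hψg hu hCR hz hab (fun T hT => ?_) (fun T hT => ?_)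
    · rw [agrad_crMap]
      exact ⟨_, _, apply_D_conj hφ hφ1 _, (hφ1.coe_toReal _).symm, by ring⟩
    · rw [crMap_center]
      refine ⟨_, _, apply_D_conj (hg T hT) (hg1 T hT) _, ((hg1 T hT).coe_toReal _).symm, ?_⟩
      simp [mul_comm, hs]
  refine ⟨_, humem, ?_, ?_, heq⟩
  · rw [ae_domain_iff (𝒯 := 𝒯) hΩ]
    intro T hT
    filter_upwards [hψg T hT, ae_restrict_mem isOpen_interior.measurableSet] with x hx hxT
    rw [hu T hT hxT, crMap_apply, hx, divh_eq hz hT hxT, proj_eq hz hT hxT, rtMap_center,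
      proj_id hT hxT]
  · exact isMinOn_iff.2 fun v hv => heq ▸ dual_le_primal hd hΩ hΓ hφ hg hψg hv hzmem

end Triangulation

end Marini

theorem proposition3p5 (d : ℕ) (hd : 1 ≤ d)
    (Ω ΓD ΓN : Set (Marini.E d))
    (hΩ : interior (closure Ω) = Ω)
    (hΓ : ΓD ∪ ΓN = frontier Ω) (hdisj : Disjoint ΓD ΓN) (hΓD : IsClosed ΓD)
    (𝒯 : Marini.Triangulation d Ω)
    (φ : Marini.E d → EReal) (hφ : Marini.ProperConvexLSC φ)
    (ψ : Marini.E d → ℝ → EReal)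
    (hψ : ∀ᵐ x ∂(volume.restrict Ω), Marini.ProperConvexLSC (ψ x))
    (hψ_const : ∀ T ∈ 𝒯.elements, ∃ g : ℝ → EReal,
      ∀ᵐ x ∂(volume.restrict (convexHull ℝ (T : Set (Marini.E d)))), ∀ t, ψ x t = g t) :
    (Marini.IsC1 φ → (∀ᵐ x ∂(volume.restrict Ω), Marini.IsC1 (ψ x)) →
      ∀ u ∈ 𝒯.crSpace ΓD, IsMinOn (Marini.primal 𝒯 φ ψ) (𝒯.crSpace ΓD) u →
        ∃ z ∈ 𝒯.rtSpace ΓN,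
          (∀ᵐ x ∂(volume.restrict Ω),
            z x = Marini.D φ (Marini.gradh u x)
              + (Marini.D (ψ x) (𝒯.proj u x) / (d : ℝ)) • (x - 𝒯.proj id x)) ∧
          IsMaxOn (Marini.dual 𝒯 φ ψ) (𝒯.rtSpace ΓN) z ∧
          Marini.primal 𝒯 φ ψ u = Marini.dual 𝒯 φ ψ z) ∧
    (Marini.IsC1 (Marini.conj φ) → (∀ᵐ x ∂(volume.restrict Ω), Marini.IsC1 (Marini.conj (ψ x))) →
      ∀ z ∈ 𝒯.rtSpace ΓN, IsMaxOn (Marini.dual 𝒯 φ ψ) (𝒯.rtSpace ΓN) z →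
        ∃ u ∈ 𝒯.crSpace ΓD,
          (∀ᵐ x ∂(volume.restrict Ω),
            u x = Marini.D (Marini.conj (ψ x)) (Marini.divh z x)
              + inner ℝ (Marini.D (Marini.conj φ) (𝒯.proj z x)) (x - 𝒯.proj id x)) ∧
          IsMinOn (Marini.primal 𝒯 φ ψ) (𝒯.crSpace ΓD) u ∧
          Marini.primal 𝒯 φ ψ u = Marini.dual 𝒯 φ ψ z) := by
  obtain ⟨g, hψg⟩ : ∃ g : Finset (Marini.E d) → ℝ → EReal, ∀ T ∈ 𝒯.elements,
      ∀ᵐ x ∂(volume.restrict (interior (convexHull ℝ (T : Set (Marini.E d))))), ψ x = g T := by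
    choose! g hg using hψ_const
    exact ⟨g, fun T hT => (ae_restrict_of_ae_restrict_of_subset interior_subset (hg T hT)).mono
      fun x hx => funext hx⟩
  have hg := Marini.Triangulation.of_ae_domain hΩ hψg hψ
  constructor
  · intro hφ1 hψ1 u hu hmin
    exact Marini.Triangulation.exists_dual_solution hd hΩ hΓ hdisj hφ hg hψg hφ1
      (Marini.Triangulation.of_ae_domain hΩ hψg hψ1) hu hmin
  · intro hφ1 hψ1 z hz hmax
    exact Marini.Triangulation.exists_primal_solution hd hΩ hΓ hdisj hφ hg hψg hφ1
      (Marini.Triangulation.of_ae_domain (P := fun f => Marini.IsC1 (Marini.conj f)) hΩ hψg hψ1)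
      hz hmax
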